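/- Let $\mathcal H$ and $\mathcal K$ be complex Hilbert spaces, let $H_0$ be a self-adjoint (in general unbounded) operator in $\mathcal H$, and let $G$ be a linear operator from $\mathcal H$ to $\mathcal K$ and $J$ an operator in $\mathcal K$ such that $$\operatorname{Dom}(|H_0|+I)^{1/2}\subset\operatorname{Dom}G,\qquad G(|H_0|+I)^{-1/2}\ \text{is compact},\qquad J=J^*\ \text{is bounded},\qquad 0\in\rho(J).$$ For $z\in\mathbb C\setminus\mathbb R$ put $$T(z)=\bigl(G(|H_0|+I)^{-1/2}\bigr)\,\frac{|H_0|+I}{H_0-zI}\,\bigl(G(|H_0|+I)^{-1/2}\bigr)^*,$$ and let $H=H(H_0,G,J)$ (formally $H_0+G^*JG$) be the self-adjoint operator in $\mathcal H$ defined by the resolvent equation $$(H-zI)^{-1}-(H_0-zI)^{-1}=-\bigl(G(H_0-\overline zI)^{-1}\bigr)^*(I+JT(z))^{-1}JG(H_0-zI)^{-1},\qquad z\in\mathbb C\setminus\mathbb R.$$ Fix the branch $\arg w\in(-\pi,\pi)$ for $w\in\mathbb C\setminus(-\infty,0]$. Then: (i) for every $z\in\mathbb C$ with $\operatorname{Im}z>0$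 the operator $\arg(H-zI)-\arg(H_0-zI)$ is compact; (ii) for every $\lambda\in\mathbb R$, $$\lim_{y\to+\infty}\bigl\|\arg(H-(\lambda+iy)I)-\arg(H_0-(\lambda+iy)I)\bigr\|=0.$$ -/

import Mathlib

open Filter Topology Set

noncomputable section

namespace SelfAdjointPair

variable {E F : Type*}
  [NormedAddCommGroup E] [InnerProductSpace ℂ E] [CompleteSpace E]
  [NormedAddCommGroup F] [InnerProductSpace ℂ F] [CompleteSpace F]

/-! ### Products and resolvents of (unbounded) linear operators -/

/-- `C = G B`: the product of the operator `G` and the everywhere defined bounded operator `B`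
is everywhere defined (`B` maps into `Dom G`) and equal to the bounded operator `C`. -/
def IsProduct (G : E →ₗ.[ℂ] F) (B : E →L[ℂ] E) (C : E →L[ℂ] F) : Prop :=
  ∀ x : E, (B x, C x) ∈ G.graph

open Classical in
/-- The product `G B` as a bounded operator (`0` if it is not everywhere defined and bounded). -/
def product (G : E →ₗ.[ℂ] F) (B : E →L[ℂ] E) : E →L[ℂ] F :=
  if h : ∃ C : E →L[ℂ] F, IsProduct G B C then h.choose else 0

/-- `R` is a bounded two-sided inverse of `A - z I`. -/
def IsResolvent (A : E →ₗ.[ℂ] E) (z : ℂ) (R : E →L[ℂ] E) : Prop :=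
  (∀ y : E, ∃ h : R y ∈ A.domain, A ⟨R y, h⟩ - z • R y = y) ∧
    ∀ x : A.domain, R (A x - z • (x : E)) = x

open Classical in
/-- The resolvent `(A - z I)⁻¹` (`0` if `z` is not in the resolvent set of `A`). -/
def res (A : E →ₗ.[ℂ] E) (z : ℂ) : E →L[ℂ] E :=
  if h : ∃ R : E →L[ℂ] E, IsResolvent A z R then h.choose else 0

/-! ### Functions of a self-adjoint operator

For a self-adjoint `A`, the bounded transform `Z = A (I + A²)^{-1/2}` is a bounded self-adjoint
operator with spectrum in `[-1, 1]`, and `x ↦ x (1 + x²)^{-1/2}` is a homeomorphism of `ℝ` onto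
`(-1, 1)` with inverse `t ↦ t (1 - t²)^{-1/2}`. Hence, for `f` continuous on `ℝ` with finite limits
at `±∞`, the operator `f(A)` is the continuous function `t ↦ f (t (1 - t²)^{-1/2})` of `Z`, where
the function is extended by continuity to the points `±1`. -/

/-- `(I + A²)^{-1/2}`, the positive square root of `(I + A²)⁻¹ = (A + i I)⁻¹ (A - i I)⁻¹`. -/
def invSqrtOneAddSq (A : E →ₗ.[ℂ] E) : E →L[ℂ] E :=
  CFC.sqrt (res A (-Complex.I) * res A Complex.I)

/-- The bounded transform `A (I + A²)^{-1/2}`. -/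
def boundedTransform (A : E →ₗ.[ℂ] E) : E →L[ℂ] E :=
  product A (invSqrtOneAddSq A)

/-- `f(A)` for a self-adjoint operator `A` and a function `f`, continuous on `ℝ` with finite limits
at `+∞` and at `-∞`. -/
def fn (f : ℝ → ℂ) (A : E →ₗ.[ℂ] E) : E →L[ℂ] E :=
  cfc (fun w : ℂ ↦ extendFrom (Ioo (-1 : ℝ) 1) (fun t ↦ f (t / √(1 - t ^ 2))) w.re)
    (boundedTransform A)

/-- `(|A| + I)^{-1/2}`. -/
def invSqrtAbsAddOne (A : E →ₗ.[ℂ] E) : E →L[ℂ] E :=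
  fn (fun x ↦ ((1 / √(|x| + 1) : ℝ) : ℂ)) A

/-- `(|A| + I)^{1/2}`, the unbounded inverse of the injective operator `(|A| + I)^{-1/2}`; its
domain is the range of `(|A| + I)^{-1/2}`. -/
def sqrtAbsAddOne (A : E →ₗ.[ℂ] E) : E →ₗ.[ℂ] E :=
  ((invSqrtAbsAddOne A : E →ₗ[ℂ] E).toPMap ⊤).inverse

/-- `(|A| + I) (A - z I)⁻¹`, for nonreal `z`. -/
def absAddOneDivSub (A : E →ₗ.[ℂ] E) (z : ℂ) : E →L[ℂ] E :=
  fn (fun x ↦ ((|x| + 1 : ℝ) : ℂ) / ((x : ℂ) - z)) A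

/-- `arg (A - z I)` for `z` in the open upper half-plane, with `arg` in `(-π, π)` off the negative
half-line. For real `x` the number `x - z` has negative imaginary part. -/
def argSub (A : E →ₗ.[ℂ] E) (z : ℂ) : E →L[ℂ] E :=
  fn (fun x ↦ ((Complex.arg ((x : ℂ) - z) : ℝ) : ℂ)) A

/-! ### The operator `H(H₀, G, J)` -/

/-- The assumptions on `G` and `J`: `Dom (|H₀| + I)^{1/2} ⊆ Dom G`, the operator
`G (|H₀| + I)^{-1/2}` is compact, `J` is bounded and self-adjoint, and `0` is in its resolvent
set. -/
structure Admissible (H₀ : E →ₗ.[ℂ] E) (G : E →ₗ.[ℂ] F) (J : F →L[ℂ] F) : Prop where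
  domain_le : (sqrtAbsAddOne H₀).domain ≤ G.domain
  compact : ∃ C : E →L[ℂ] F, IsProduct G (invSqrtAbsAddOne H₀) C ∧ IsCompactOperator C
  selfAdjoint : IsSelfAdjoint J
  zero_mem : (0 : ℂ) ∈ resolventSet ℂ J

/-- `T(z) = (G (|H₀| + I)^{-1/2}) ((|H₀| + I) (H₀ - z I)⁻¹) (G (|H₀| + I)^{-1/2})*`. -/
def sandwich (H₀ : E →ₗ.[ℂ] E) (G : E →ₗ.[ℂ] F) (z : ℂ) : F →L[ℂ] F :=
  (product G (invSqrtAbsAddOne H₀)).comp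
    ((absAddOneDivSub H₀ z).comp
      (ContinuousLinearMap.adjoint (product G (invSqrtAbsAddOne H₀))))

/-- `H = H(H₀, G, J)`: the self-adjoint operator, corresponding to the formal sum `H₀ + G* J G`,
that is defined by the resolvent equation
`(H - z)⁻¹ - (H₀ - z)⁻¹ = - (G (H₀ - z̄)⁻¹)* (I + J T(z))⁻¹ J G (H₀ - z)⁻¹` for all nonreal `z`. -/
structure IsPerturbation (H₀ : E →ₗ.[ℂ] E) (G : E →ₗ.[ℂ] F) (J : F →L[ℂ] F)
    (H : E →ₗ.[ℂ] E) : Prop where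
  selfAdjoint : IsSelfAdjoint H
  resolvent_eq : ∀ z : ℂ, z.im ≠ 0 →
    res H z - res H₀ z =
      -((ContinuousLinearMap.adjoint (product G (res H₀ (starRingEnd ℂ z)))).comp
        ((Ring.inverse (1 + J * sandwich H₀ G z)).comp (J.comp (product G (res H₀ z)))))

/-! ### The condition on a pair of self-adjoint operators -/

/-- (i) `arg (H - z I) - arg (H₀ - z I)` is compact for all `z` in the open upper half-plane;
(ii) for every real `l` its norm at `z = l + i y` tends to `0` as `y → +∞`. -/
structure ArgCondition (H₀ H : E →ₗ.[ℂ] E) : Prop where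
  compact : ∀ z : ℂ, 0 < z.im → IsCompactOperator (argSub H z - argSub H₀ z)
  tendsto : ∀ l : ℝ,
    Tendsto (fun y : ℝ ↦ ‖argSub H (l + y * Complex.I) - argSub H₀ (l + y * Complex.I)‖)
      atTop (𝓝 0)

end SelfAdjointPair

end

set_option linter.unusedSectionVars false

noncomputable section

namespace SelfAdjointPair

open scoped ComplexConjugate InnerProductSpace

variable {E F : Type*}
  [NormedAddCommGroup E] [InnerProductSpace ℂ E] [CompleteSpace E]
  [NormedAddCommGroup F] [InnerProductSpace ℂ F] [CompleteSpace F]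

/-! ### Resolvents of a self-adjoint operator -/

section Resolvent

variable {A : E →ₗ.[ℂ] E}

/-! For `z = l + iy` with `y > 0` one has `arg (x - z) = arctan ((x - l) / y) - π / 2`, so the
constant cancels and both claims concern `D(y) = arctan ((H - l) / y) - arctan ((H₀ - l) / y)`. The
`y`-derivative of the arctangent is `-Re (x - z)⁻¹`; hence `D'(y)` is `-1/2` times the sum of the
resolvent differences at `z` and at `z̄` (`hasDerivAt_arctanDiff`). By the resolvent equation these
differences are compact, and `D(y) → 0` strongly as `y → ∞`. If the convergence holds in norm, then
`D(y)` is compact as well: modulo the closed subspace of compact operators `D` is constant and tends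
to zero (`mem_of_hasDerivAt_mem`). So (i) follows from (ii).

For (ii), estimating `‖D'(y)‖` need not give something integrable, so quadratic forms are integrated
instead. Put `C = G (|H₀| + I)^{-1/2}`. For large `y` the operator `J T(z)` is small
(`exists_norm_sandwich_le`), its Neumann inverse has norm at most `2`, and `|Re ⟪g, D'(y) f⟫|` is at
most `‖J‖ (k_y(g) + k_y(f))`, where `k_y(v)` bounds `‖C (|H₀| + I)^{1/2} (H₀ - w)⁻¹ v‖²` for `w = z,
z̄`. Since `|x - z|` is comparable to `|x| + y`, one can take `k_y` to be minus the `y`-derivative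
of the nonnegative form of an explicit function of `H₀`, the `majorant`. Integrating from `y` to
infinity (`le_of_deriv_le_neg_deriv`) bounds `‖D(y)‖` by a multiple of the supremum of the majorant.

Boundedness of `C` alone makes this supremum bounded; compactness makes it small. By
`exists_cutoff`, `C` is within `ε` of `C p(H₀)` with `p(x) = R / (|x| + R)`, and the majorant is
then of order `R / y + ε²`. -/

theorem inner_graph_symm (hA : IsSelfAdjoint A) {x u y v : E} (hx : (x, u) ∈ A.graph)
    (hy : (y, v) ∈ A.graph) : ⟪u, y⟫_ℂ = ⟪x, v⟫_ℂ := by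
  have h := LinearPMap.adjoint_graph_eq_graph_adjoint hA.dense_domain
  rw [LinearPMap.isSelfAdjoint_def.mp hA] at h
  rw [h, Submodule.mem_adjoint_iff] at hy
  exact sub_eq_zero.mp (hy x u hx)

theorem mem_graph_of_inner (hA : IsSelfAdjoint A) {y v : E}
    (h : ∀ x u, (x, u) ∈ A.graph → ⟪u, y⟫_ℂ = ⟪x, v⟫_ℂ) : (y, v) ∈ A.graph := by
  have h' := LinearPMap.adjoint_graph_eq_graph_adjoint hA.dense_domain
  rw [LinearPMap.isSelfAdjoint_def.mp hA] at h'
  rw [h', Submodule.mem_adjoint_iff]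
  exact fun a b hab ↦ sub_eq_zero.mpr (h a b hab)

theorem isClosed_graph (hA : IsSelfAdjoint A) : IsClosed (A.graph : Set (E × E)) :=
  hA.isClosed

/-- Since `⟪x, A x⟫` is real, the imaginary part of `⟪x, (A - z) x⟫` is `-Im z ‖x‖²`; then
Cauchy-Schwarz. -/
theorem abs_im_mul_norm_le (hA : IsSelfAdjoint A) (z : ℂ) {x u : E} (hx : (x, u) ∈ A.graph) :
    |z.im| * ‖x‖ ≤ ‖u - z • x‖ := by
  have hreal : (⟪x, u⟫_ℂ).im = 0 := by
    have h := inner_graph_symm hA hx hx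
    rw [← inner_conj_symm] at h
    exact Complex.conj_eq_iff_im.mp h
  have h1 : (⟪x, u - z • x⟫_ℂ).im = -(z.im * ‖x‖ ^ 2) := by
    rw [inner_sub_right, inner_smul_right, inner_self_eq_norm_sq_to_K, Complex.sub_im, hreal]
    have e : ((‖x‖ : ℂ) ^ 2) = ((‖x‖ ^ 2 : ℝ) : ℂ) := by push_cast; rfl
    rw [zero_sub, neg_inj]
    exact (congrArg (fun w ↦ (z * w).im) e).trans (Complex.im_mul_ofReal _ _)
  have h2 : |z.im| * ‖x‖ ^ 2 ≤ ‖x‖ * ‖u - z • x‖ := by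
    calc |z.im| * ‖x‖ ^ 2 = |(⟪x, u - z • x⟫_ℂ).im| := by
          rw [h1, abs_neg, abs_mul, abs_of_nonneg (sq_nonneg ‖x‖)]
      _ ≤ ‖⟪x, u - z • x⟫_ℂ‖ := Complex.abs_im_le_norm _
      _ ≤ _ := norm_inner_le_norm _ _
  rcases (norm_nonneg x).eq_or_lt with h | h
  · rw [← h, mul_zero]; positivity
  · refine le_of_mul_le_mul_left ?_ h
    linarith [h2]

/-- The map `(x, A x) ↦ A x - z x` on the graph of `A`. -/
def graphSub (A : E →ₗ.[ℂ] E) (z : ℂ) : A.graph →L[ℂ] E :=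
  (ContinuousLinearMap.snd ℂ E E - z • ContinuousLinearMap.fst ℂ E E).comp A.graph.subtypeL

@[simp] theorem graphSub_apply (z : ℂ) (p : A.graph) :
    graphSub A z p = p.1.2 - z • p.1.1 := rfl

theorem antilipschitz_graphSub (hA : IsSelfAdjoint A) {z : ℂ} (hz : z.im ≠ 0) :
    ∃ K, AntilipschitzWith K (graphSub A z) := by
  have hz' : 0 < |z.im| := abs_pos.mpr hz
  refine ⟨Real.toNNReal (1 + (1 + ‖z‖) / |z.im|), ?_⟩
  refine (graphSub A z).antilipschitz_of_bound fun p ↦ ?_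
  rw [Real.coe_toNNReal _ (by positivity), graphSub_apply]
  obtain ⟨⟨x, u⟩, hp⟩ := p
  have h1 := abs_im_mul_norm_le hA z hp
  simp only [Submodule.coe_norm]
  set N := ‖u - z • x‖
  have hx : ‖x‖ ≤ N / |z.im| := by rw [le_div_iff₀ hz']; linarith
  have hu : ‖u‖ ≤ N + ‖z‖ * ‖x‖ := by
    calc ‖u‖ = ‖(u - z • x) + z • x‖ := by simp
      _ ≤ _ := (norm_add_le _ _).trans (by rw [norm_smul])
  have e : (1 + (1 + ‖z‖) / |z.im|) * N = N + N / |z.im| + ‖z‖ * (N / |z.im|) := by ring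
  have hN : 0 ≤ N := norm_nonneg _
  have hN' : 0 ≤ N / |z.im| := by positivity
  rw [e, Prod.norm_def]
  refine max_le ?_ ?_
  · show ‖x‖ ≤ _
    nlinarith [mul_nonneg (norm_nonneg z) hN']
  · show ‖u‖ ≤ _
    nlinarith [mul_le_mul_of_nonneg_left hx (norm_nonneg z)]

/-- The range is closed, because the map is bounded below on a complete graph. A vector orthogonal
to it would satisfy `A y = z̄ y`, which the lower bound at `z̄` excludes unless `y = 0`. -/
theorem surjective_graphSub (hA : IsSelfAdjoint A) {z : ℂ} (hz : z.im ≠ 0) :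
    Function.Surjective (graphSub A z) := by
  obtain ⟨K, hK⟩ := antilipschitz_graphSub hA hz
  have : CompleteSpace A.graph := (isClosed_graph hA).completeSpace_coe
  have hcl : IsClosed (Set.range (graphSub A z)) :=
    hK.isClosed_range (graphSub A z).uniformContinuous
  have hcl' : IsClosed ((graphSub A z).range : Set E) := by
    rw [LinearMap.coe_range]
    exact hcl
  have : CompleteSpace (graphSub A z).range := hcl'.completeSpace_coe
  have hbot : (graphSub A z).rangeᗮ = ⊥ := by
    rw [Submodule.eq_bot_iff]
    intro y hy
    rw [Submodule.mem_orthogonal] at hy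
    have hmem : (y, conj z • y) ∈ A.graph := by
      refine mem_graph_of_inner hA fun x u hx ↦ ?_
      have := hy (graphSub A z ⟨(x, u), hx⟩) ⟨_, rfl⟩
      rw [graphSub_apply, inner_sub_left, inner_smul_left, sub_eq_zero] at this
      rw [inner_smul_right]
      exact this
    have h1 := abs_im_mul_norm_le hA (conj z) hmem
    rw [sub_self, norm_zero, Complex.conj_im, abs_neg] at h1
    have hz' : 0 < |z.im| := abs_pos.mpr hz
    exact norm_le_zero_iff.mp (nonpos_of_mul_nonpos_right h1 hz')
  have htop := (Submodule.orthogonal_eq_bot_iff).mp hbot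
  exact LinearMap.range_eq_top.mp htop

theorem isResolvent_iff {z : ℂ} {R : E →L[ℂ] E} :
    IsResolvent A z R ↔ (∀ y, (R y, y + z • R y) ∈ A.graph) ∧
      ∀ x u, (x, u) ∈ A.graph → R (u - z • x) = x := by
  constructor
  · rintro ⟨h1, h2⟩
    refine ⟨fun y ↦ ?_, fun x u hx ↦ ?_⟩
    · obtain ⟨h, e⟩ := h1 y
      rw [LinearPMap.mem_graph_iff]
      exact ⟨⟨R y, h⟩, rfl, sub_eq_iff_eq_add.mp e⟩
    · obtain ⟨x', rfl, rfl⟩ := (LinearPMap.mem_graph_iff A).mp hx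
      exact h2 x'
  · rintro ⟨h1, h2⟩
    refine ⟨fun y ↦ ?_, fun x ↦ h2 _ _ (LinearPMap.mem_graph A x)⟩
    obtain ⟨x', e1, e2⟩ := (LinearPMap.mem_graph_iff A).mp (h1 y)
    simp only at e1 e2
    have h : R y ∈ A.domain := e1 ▸ x'.2
    have : (⟨R y, h⟩ : A.domain) = x' := Subtype.ext e1.symm
    exact ⟨h, by rw [this, e2]; simp⟩

theorem exists_isResolvent (hA : IsSelfAdjoint A) {z : ℂ} (hz : z.im ≠ 0) :
    ∃ R : E →L[ℂ] E, IsResolvent A z R := by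
  have : CompleteSpace A.graph := (isClosed_graph hA).completeSpace_coe
  obtain ⟨K, hK⟩ := antilipschitz_graphSub hA hz
  let e := ContinuousLinearEquiv.ofBijective (graphSub A z)
    (LinearMap.ker_eq_bot.mpr hK.injective)
    (LinearMap.range_eq_top.mpr (surjective_graphSub hA hz))
  have he : ∀ p, e p = p.1.2 - z • p.1.1 := fun p ↦ rfl
  refine ⟨(ContinuousLinearMap.fst ℂ E E).comp (A.graph.subtypeL.comp
    (e.symm : E →L[ℂ] A.graph)), isResolvent_iff.mpr ⟨fun y ↦ ?_, fun x u hx ↦ ?_⟩⟩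
  · have h1 := he (e.symm y)
    rw [e.apply_symm_apply] at h1
    have h2 : y + z • (e.symm y).1.1 = (e.symm y).1.2 := by
      exact sub_eq_iff_eq_add.mp h1.symm ▸ rfl
    show ((e.symm y).1.1, y + z • (e.symm y).1.1) ∈ A.graph
    rw [h2]
    exact (e.symm y).2
  · have h1 : e ⟨(x, u), hx⟩ = u - z • x := rfl
    show (e.symm (u - z • x)).1.1 = x
    rw [← h1, e.symm_apply_apply]

theorem isResolvent_res (hA : IsSelfAdjoint A) {z : ℂ} (hz : z.im ≠ 0) :
    IsResolvent A z (res A z) := by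
  have h := exists_isResolvent hA hz
  rw [res, dif_pos h]
  exact h.choose_spec

theorem res_mem_graph (hA : IsSelfAdjoint A) {z : ℂ} (hz : z.im ≠ 0) (y : E) :
    (res A z y, y + z • res A z y) ∈ A.graph :=
  (isResolvent_iff.mp (isResolvent_res hA hz)).1 y

theorem res_sub_smul (hA : IsSelfAdjoint A) {z : ℂ} (hz : z.im ≠ 0) {x u : E}
    (h : (x, u) ∈ A.graph) : res A z (u - z • x) = x :=
  (isResolvent_iff.mp (isResolvent_res hA hz)).2 x u h

theorem star_res (hA : IsSelfAdjoint A) {z : ℂ} (hz : z.im ≠ 0) :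
    star (res A z) = res A (conj z) := by
  have hz' : (conj z).im ≠ 0 := by simpa using hz
  rw [ContinuousLinearMap.star_eq_adjoint, eq_comm, ContinuousLinearMap.eq_adjoint_iff]
  intro a b
  have h := inner_graph_symm hA (res_mem_graph hA hz' a) (res_mem_graph hA hz b)
  rw [inner_add_left, inner_add_right, inner_smul_left, inner_smul_right,
    Complex.conj_conj] at h
  exact (add_right_cancel h).symm

theorem res_sub_res (hA : IsSelfAdjoint A) {z w : ℂ} (hz : z.im ≠ 0) (hw : w.im ≠ 0) :
    res A z - res A w = (z - w) • (res A z * res A w) := by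
  ext a
  have h := res_sub_smul hA hz (res_mem_graph hA hw a)
  rw [add_sub_assoc, ← sub_smul, map_add, map_smul] at h
  have e : (res A z - res A w) a = res A z a - res A w a := rfl
  rw [e, sub_eq_iff_eq_add]
  show _ = (z - w) • res A z (res A w a) + _
  linear_combination (norm := module) h

end Resolvent

/-! ### The bounded transform -/

section BoundedTransform

theorem I_im_ne_zero : Complex.I.im ≠ 0 := by simp

theorem neg_I_im_ne_zero : (-Complex.I).im ≠ 0 := by simp

theorem mul_right_cancel_of_denseRange {S X Y : E →L[ℂ] E} (hS : DenseRange S)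
    (h : X * S = Y * S) : X = Y := by
  have : (X : E → E) = Y := hS.equalizer X.continuous Y.continuous
    (funext fun x ↦ congrArg (fun T : E →L[ℂ] E ↦ T x) h)
  exact DFunLike.coe_injective this

theorem mul_left_cancel_of_injective {S X Y : E →L[ℂ] E} (hS : Function.Injective S)
    (h : S * X = S * Y) : X = Y := by
  ext x
  exact hS (congrArg (fun T : E →L[ℂ] E ↦ T x) h)

theorem denseRange_of_injective {S : E →L[ℂ] E} (hsa : IsSelfAdjoint S)
    (hS : Function.Injective S) : DenseRange S := by
  have h1 : S.rangeᗮ = ⊥ := by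
    rw [Submodule.eq_bot_iff]
    intro y hy
    rw [Submodule.mem_orthogonal] at hy
    apply hS
    rw [map_zero, ← inner_self_eq_zero (𝕜 := ℂ)]
    have h2 := hy (S (S y)) ⟨_, rfl⟩
    have h3 := ContinuousLinearMap.adjoint_inner_right S (S y) y
    rw [← ContinuousLinearMap.star_eq_adjoint, hsa.star_eq] at h3
    rw [h3, h2]
  have h2 := (Submodule.topologicalClosure_eq_top_iff).mpr h1
  have h3 := Submodule.dense_iff_topologicalClosure_eq_top.mpr h2
  rw [LinearMap.coe_range] at h3
  exact h3

variable {A : E →ₗ.[ℂ] E}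

theorem injective_res (hA : IsSelfAdjoint A) {z : ℂ} (hz : z.im ≠ 0) :
    Function.Injective (res A z) := by
  rw [injective_iff_map_eq_zero]
  intro y hy
  have h := res_mem_graph hA hz y
  rw [hy, smul_zero, add_zero] at h
  exact LinearPMap.graph_fst_eq_zero_snd A h rfl

theorem star_res_I (hA : IsSelfAdjoint A) :
    star (res A Complex.I) = res A (-Complex.I) := by
  rw [star_res hA I_im_ne_zero, Complex.conj_I]

theorem res_I_sub_res_neg_I (hA : IsSelfAdjoint A) :
    res A Complex.I - res A (-Complex.I) =
      (2 * Complex.I) • (res A (-Complex.I) * res A Complex.I) := by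
  have h := res_sub_res hA neg_I_im_ne_zero I_im_ne_zero
  rw [← neg_sub, h, ← neg_smul]
  congr 1
  ring

theorem commute_res_I (hA : IsSelfAdjoint A) :
    res A Complex.I * res A (-Complex.I) = res A (-Complex.I) * res A Complex.I := by
  have h := res_sub_res hA I_im_ne_zero neg_I_im_ne_zero
  rw [res_I_sub_res_neg_I hA, sub_neg_eq_add, ← two_mul] at h
  exact (smul_right_injective _ (by simp) h).symm

theorem res_mul_res_nonneg (hA : IsSelfAdjoint A) :
    0 ≤ res A (-Complex.I) * res A Complex.I := by
  rw [← star_res_I hA]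
  exact star_mul_self_nonneg _

theorem invSqrtOneAddSq_nonneg : 0 ≤ invSqrtOneAddSq A := CFC.sqrt_nonneg _

theorem isSelfAdjoint_invSqrtOneAddSq : IsSelfAdjoint (invSqrtOneAddSq A) :=
  IsSelfAdjoint.of_nonneg invSqrtOneAddSq_nonneg

theorem invSqrtOneAddSq_mul_self (hA : IsSelfAdjoint A) :
    invSqrtOneAddSq A * invSqrtOneAddSq A = res A (-Complex.I) * res A Complex.I :=
  CFC.sqrt_mul_sqrt_self _ (res_mul_res_nonneg hA)

theorem commute_invSqrtOneAddSq_res (hA : IsSelfAdjoint A) :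
    Commute (invSqrtOneAddSq A) (res A Complex.I) := by
  refine Commute.cfcₙ_nnreal ?_ _
  show _ * _ * _ = _ * (_ * _)
  rw [← mul_assoc, commute_res_I hA]

theorem injective_invSqrtOneAddSq (hA : IsSelfAdjoint A) :
    Function.Injective (invSqrtOneAddSq A) := by
  rw [injective_iff_map_eq_zero]
  intro x hx
  have h : (invSqrtOneAddSq A * invSqrtOneAddSq A) x = 0 := by
    show invSqrtOneAddSq A (invSqrtOneAddSq A x) = 0
    rw [hx, map_zero]
  rw [invSqrtOneAddSq_mul_self hA] at h
  have h' := (injective_iff_map_eq_zero _).mp (injective_res hA neg_I_im_ne_zero) _ h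
  exact (injective_iff_map_eq_zero _).mp (injective_res hA I_im_ne_zero) _ h'

theorem denseRange_invSqrtOneAddSq (hA : IsSelfAdjoint A) : DenseRange (invSqrtOneAddSq A) :=
  denseRange_of_injective isSelfAdjoint_invSqrtOneAddSq (injective_invSqrtOneAddSq hA)

/-- `A (I + A²)⁻¹` as a polynomial in the resolvents. -/
def mulInvOneAddSq (A : E →ₗ.[ℂ] E) : E →L[ℂ] E :=
  res A Complex.I - Complex.I • (invSqrtOneAddSq A * invSqrtOneAddSq A)

theorem mulInvOneAddSq_mem_graph (hA : IsSelfAdjoint A) (w : E) :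
    (invSqrtOneAddSq A (invSqrtOneAddSq A w), mulInvOneAddSq A w) ∈ A.graph := by
  have h := res_mem_graph hA neg_I_im_ne_zero (res A Complex.I w)
  have e : invSqrtOneAddSq A (invSqrtOneAddSq A w) = res A (-Complex.I) (res A Complex.I w) :=
    congrArg (fun T : E →L[ℂ] E ↦ T w) (invSqrtOneAddSq_mul_self hA)
  have e' : mulInvOneAddSq A w =
      res A Complex.I w - Complex.I • invSqrtOneAddSq A (invSqrtOneAddSq A w) := rfl
  rw [e', e, sub_eq_add_neg, ← neg_smul]
  exact h

theorem isSelfAdjoint_mulInvOneAddSq (hA : IsSelfAdjoint A) :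
    IsSelfAdjoint (mulInvOneAddSq A) := by
  have h := res_I_sub_res_neg_I hA
  rw [← invSqrtOneAddSq_mul_self hA] at h
  rw [isSelfAdjoint_iff, mulInvOneAddSq, star_sub, star_smul, star_mul, star_res_I hA,
    isSelfAdjoint_invSqrtOneAddSq.star_eq, Complex.star_def, Complex.conj_I]
  linear_combination (norm := module) -h

/-- The operator form of `x² / (1 + x²)² = 1 / (1 + x²) - 1 / (1 + x²)²`, derived from the resolvent
identity alone because no functional calculus for `A` exists yet. -/
theorem mulInvOneAddSq_mul_self (hA : IsSelfAdjoint A) :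
    mulInvOneAddSq A * mulInvOneAddSq A =
      invSqrtOneAddSq A * invSqrtOneAddSq A - invSqrtOneAddSq A * invSqrtOneAddSq A *
        (invSqrtOneAddSq A * invSqrtOneAddSq A) := by
  have h := res_I_sub_res_neg_I hA
  have hB := invSqrtOneAddSq_mul_self hA
  have hc : Commute (invSqrtOneAddSq A * invSqrtOneAddSq A) (res A Complex.I) :=
    (commute_invSqrtOneAddSq_res hA).mul_left (commute_invSqrtOneAddSq_res hA)
  have hc' := commute_res_I hA
  rw [← hB] at h hc'
  rw [mulInvOneAddSq]
  set B := invSqrtOneAddSq A * invSqrtOneAddSq A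
  set R := res A Complex.I
  have h1 : R * R - B = (2 * Complex.I) • (R * B) := by
    calc R * R - B = R * R - R * res A (-Complex.I) := by rw [hc']
      _ = _ := by rw [← mul_sub, h, mul_smul_comm]
  have hI : Complex.I ^ 2 • (B * B) = (-1 : ℂ) • (B * B) := by rw [Complex.I_sq]
  simp only [sub_mul, mul_sub, smul_mul_assoc, mul_smul_comm]
  rw [hc.eq]
  linear_combination (norm := module) h1 + hI

theorem commute_invSqrtOneAddSq_mulInvOneAddSq (hA : IsSelfAdjoint A) :
    Commute (invSqrtOneAddSq A) (mulInvOneAddSq A) :=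
  (commute_invSqrtOneAddSq_res hA).sub_right
    (((Commute.refl _).mul_right (Commute.refl _)).smul_right _)

theorem inner_star_mul (T : E →L[ℂ] E) (x : E) : ⟪x, (star T * T) x⟫_ℂ = (‖T x‖ : ℂ) ^ 2 := by
  show ⟪x, star T (T x)⟫_ℂ = _
  rw [ContinuousLinearMap.star_eq_adjoint, ContinuousLinearMap.adjoint_inner_right,
    inner_self_eq_norm_sq_to_K]
  rfl

theorem norm_sq_add_norm_sq_eq {T S X : E →L[ℂ] E} (h : star T * T + star S * S = star X * X)
    (x : E) : ‖T x‖ ^ 2 + ‖S x‖ ^ 2 = ‖X x‖ ^ 2 := by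
  have h1 := congrArg (fun Y : E →L[ℂ] E ↦ ⟪x, Y x⟫_ℂ) h
  have e : (star T * T + star S * S) x = (star T * T) x + (star S * S) x := rfl
  simp only [e, inner_add_right, inner_star_mul] at h1
  exact_mod_cast h1

theorem norm_mulInvOneAddSq_le (hA : IsSelfAdjoint A) (w : E) :
    ‖mulInvOneAddSq A w‖ ≤ ‖invSqrtOneAddSq A w‖ := by
  have hS : star (invSqrtOneAddSq A) = _ := isSelfAdjoint_invSqrtOneAddSq.star_eq
  have h := norm_sq_add_norm_sq_eq (T := mulInvOneAddSq A)
    (S := invSqrtOneAddSq A * invSqrtOneAddSq A) (X := invSqrtOneAddSq A) (by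
      rw [(isSelfAdjoint_mulInvOneAddSq hA).star_eq, mulInvOneAddSq_mul_self hA, star_mul, hS,
        sub_add_cancel]) w
  have := sq_nonneg ‖(invSqrtOneAddSq A * invSqrtOneAddSq A) w‖
  exact (sq_le_sq₀ (norm_nonneg _) (norm_nonneg _)).mp (h ▸ le_add_of_nonneg_right this)

/-- With `S = (I + A²)^{-1/2}`, the map `S w ↦ A S² w` is contractive on the dense range of `S`, so
it extends to a bounded operator. Closedness of the graph of `A` identifies the extension with `A
S`. -/
theorem exists_isProduct_invSqrtOneAddSq (hA : IsSelfAdjoint A) :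
    ∃ C : E →L[ℂ] E, IsProduct A (invSqrtOneAddSq A) C := by
  have hd := denseRange_invSqrtOneAddSq hA
  let T : E →ₗ[ℂ] E := mulInvOneAddSq A
  let S : E →ₗ[ℂ] E := invSqrtOneAddSq A
  have hn : ∃ C, ∀ x, ‖T x‖ ≤ C * ‖S x‖ :=
    ⟨1, fun x ↦ by rw [one_mul]; exact norm_mulInvOneAddSq_le hA x⟩
  have hZ := LinearMap.extendOfNorm_eq (f := T) (e := S) hd hn
  set Z := T.extendOfNorm S
  refine ⟨Z, fun x ↦ ?_⟩
  refine hd.induction_on (p := fun x ↦ (invSqrtOneAddSq A x, Z x) ∈ A.graph) x ?_ fun w ↦ ?_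
  · exact (isClosed_graph hA).preimage
      (f := fun x ↦ (invSqrtOneAddSq A x, Z x)) (by fun_prop)
  · have := mulInvOneAddSq_mem_graph hA w
    rw [show mulInvOneAddSq A w = Z (invSqrtOneAddSq A w) from (hZ w).symm] at this
    exact this

theorem isProduct_product {G : E →ₗ.[ℂ] F} {B : E →L[ℂ] E}
    (h : ∃ C : E →L[ℂ] F, IsProduct G B C) : IsProduct G B (product G B) := by
  rw [product, dif_pos h]
  exact h.choose_spec

theorem IsProduct.product_eq {G : E →ₗ.[ℂ] F} {B : E →L[ℂ] E} {C : E →L[ℂ] F}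
    (h : IsProduct G B C) : product G B = C := by
  ext x
  exact LinearPMap.mem_graph_snd_inj G (isProduct_product ⟨C, h⟩ x) (h x) rfl

theorem boundedTransform_mem_graph (hA : IsSelfAdjoint A) (x : E) :
    (invSqrtOneAddSq A x, boundedTransform A x) ∈ A.graph :=
  isProduct_product (exists_isProduct_invSqrtOneAddSq hA) x

theorem boundedTransform_mul_invSqrtOneAddSq (hA : IsSelfAdjoint A) :
    boundedTransform A * invSqrtOneAddSq A = mulInvOneAddSq A := by
  ext w
  exact LinearPMap.mem_graph_snd_inj A (boundedTransform_mem_graph hA (invSqrtOneAddSq A w))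
    (mulInvOneAddSq_mem_graph hA w) rfl

theorem invSqrtOneAddSq_mul_boundedTransform (hA : IsSelfAdjoint A) :
    invSqrtOneAddSq A * boundedTransform A = mulInvOneAddSq A := by
  rw [← boundedTransform_mul_invSqrtOneAddSq hA]
  apply mul_right_cancel_of_denseRange (denseRange_invSqrtOneAddSq hA)
  rw [mul_assoc, boundedTransform_mul_invSqrtOneAddSq hA]
  exact commute_invSqrtOneAddSq_mulInvOneAddSq hA

theorem isSelfAdjoint_boundedTransform (hA : IsSelfAdjoint A) :
    IsSelfAdjoint (boundedTransform A) := by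
  apply mul_left_cancel_of_injective (injective_invSqrtOneAddSq hA)
  rw [invSqrtOneAddSq_mul_boundedTransform hA]
  have h := congrArg star (boundedTransform_mul_invSqrtOneAddSq hA)
  rwa [star_mul, isSelfAdjoint_invSqrtOneAddSq.star_eq,
    (isSelfAdjoint_mulInvOneAddSq hA).star_eq] at h

theorem boundedTransform_mul_self (hA : IsSelfAdjoint A) :
    boundedTransform A * boundedTransform A =
      1 - invSqrtOneAddSq A * invSqrtOneAddSq A := by
  apply mul_left_cancel_of_injective (injective_invSqrtOneAddSq hA)
  apply mul_right_cancel_of_denseRange (denseRange_invSqrtOneAddSq hA)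
  rw [← mul_assoc, invSqrtOneAddSq_mul_boundedTransform hA, mul_assoc,
    boundedTransform_mul_invSqrtOneAddSq hA, mulInvOneAddSq_mul_self hA]
  simp only [mul_sub, sub_mul, mul_one, mul_assoc]

theorem norm_boundedTransform_le (hA : IsSelfAdjoint A) : ‖boundedTransform A‖ ≤ 1 := by
  refine ContinuousLinearMap.opNorm_le_bound _ zero_le_one fun x ↦ ?_
  have h := norm_sq_add_norm_sq_eq (T := boundedTransform A) (S := invSqrtOneAddSq A) (X := 1)
    (by rw [(isSelfAdjoint_boundedTransform hA).star_eq, boundedTransform_mul_self hA,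
      isSelfAdjoint_invSqrtOneAddSq.star_eq, star_one, mul_one, sub_add_cancel]) x
  have := sq_nonneg ‖invSqrtOneAddSq A x‖
  rw [one_mul]
  exact (sq_le_sq₀ (norm_nonneg _) (norm_nonneg _)).mp (h ▸ le_add_of_nonneg_right this)

theorem res_mul_boundedTransform_sub (hA : IsSelfAdjoint A) {z : ℂ} (hz : z.im ≠ 0) :
    res A z * (boundedTransform A - z • invSqrtOneAddSq A) = invSqrtOneAddSq A := by
  ext x
  exact res_sub_smul hA hz (boundedTransform_mem_graph hA x)

end BoundedTransform

/-! ### The functional calculus -/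

section FunctionalCalculus

/-- `f` is continuous on `ℝ` and has finite limits at `+∞` and at `-∞`. -/
structure HasLimits (f : ℝ → ℂ) : Prop where
  continuous : Continuous f
  atTop : ∃ a, Tendsto f atTop (𝓝 a)
  atBot : ∃ b, Tendsto f atBot (𝓝 b)

namespace HasLimits

variable {f g : ℝ → ℂ}

theorem comp (hf : HasLimits f) {φ : ℂ → ℂ} (hφ : Continuous φ) :
    HasLimits (fun x ↦ φ (f x)) where
  continuous := hφ.comp hf.continuous
  atTop := hf.atTop.imp' φ fun _ ha ↦ (hφ.tendsto _).comp ha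
  atBot := hf.atBot.imp' φ fun _ ha ↦ (hφ.tendsto _).comp ha

theorem const (c : ℂ) : HasLimits fun _ ↦ c :=
  ⟨continuous_const, ⟨c, tendsto_const_nhds⟩, ⟨c, tendsto_const_nhds⟩⟩

theorem add (hf : HasLimits f) (hg : HasLimits g) : HasLimits (fun x ↦ f x + g x) where
  continuous := hf.continuous.add hg.continuous
  atTop := let ⟨_, ha⟩ := hf.atTop; let ⟨_, hb⟩ := hg.atTop; ⟨_, ha.add hb⟩
  atBot := let ⟨_, ha⟩ := hf.atBot; let ⟨_, hb⟩ := hg.atBot; ⟨_, ha.add hb⟩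

theorem mul (hf : HasLimits f) (hg : HasLimits g) : HasLimits (fun x ↦ f x * g x) where
  continuous := hf.continuous.mul hg.continuous
  atTop := let ⟨_, ha⟩ := hf.atTop; let ⟨_, hb⟩ := hg.atTop; ⟨_, ha.mul hb⟩
  atBot := let ⟨_, ha⟩ := hf.atBot; let ⟨_, hb⟩ := hg.atBot; ⟨_, ha.mul hb⟩

theorem const_mul (hf : HasLimits f) (c : ℂ) : HasLimits (fun x ↦ c * f x) := (const c).mul hf

theorem sub (hf : HasLimits f) (hg : HasLimits g) : HasLimits (fun x ↦ f x - g x) where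
  continuous := hf.continuous.sub hg.continuous
  atTop := let ⟨_, ha⟩ := hf.atTop; let ⟨_, hb⟩ := hg.atTop; ⟨_, ha.sub hb⟩
  atBot := let ⟨_, ha⟩ := hf.atBot; let ⟨_, hb⟩ := hg.atBot; ⟨_, ha.sub hb⟩

end HasLimits

/-- The extension to `[-1, 1]` of the function corresponding to `f` under `x = t / √(1 - t²)`. -/
def extIcc (f : ℝ → ℂ) : ℝ → ℂ := extendFrom (Ioo (-1 : ℝ) 1) fun t ↦ f (t / √(1 - t ^ 2))

theorem one_sub_sq_pos {t : ℝ} (ht : t ∈ Ioo (-1 : ℝ) 1) : 0 < 1 - t ^ 2 := by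
  nlinarith [ht.1, ht.2]

theorem continuousOn_div_sqrt : ContinuousOn (fun t : ℝ ↦ t / √(1 - t ^ 2)) (Ioo (-1) 1) :=
  continuousOn_id.div (by fun_prop) fun _ ht ↦ (Real.sqrt_pos.mpr (one_sub_sq_pos ht)).ne'

theorem tendsto_div_sqrt_one : Tendsto (fun t : ℝ ↦ t / √(1 - t ^ 2)) (𝓝[<] 1) atTop := by
  have h1 : Tendsto (fun t : ℝ ↦ √(1 - t ^ 2)) (𝓝[<] 1) (𝓝[>] 0) := by
    refine tendsto_nhdsWithin_iff.mpr ⟨?_, ?_⟩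
    · have : Continuous fun t : ℝ ↦ √(1 - t ^ 2) := by fun_prop
      have h := this.tendsto 1
      norm_num at h
      exact h.mono_left nhdsWithin_le_nhds
    · filter_upwards [Ioo_mem_nhdsLT (show (-1 : ℝ) < 1 by norm_num)] with t ht
      exact Real.sqrt_pos.mpr (one_sub_sq_pos ht)
  have h2 : Tendsto (fun t : ℝ ↦ t) (𝓝[<] 1) (𝓝 1) := nhdsWithin_le_nhds
  simpa only [div_eq_mul_inv, Function.comp_def] using
    h2.pos_mul_atTop one_pos (tendsto_inv_nhdsGT_zero.comp h1)

theorem tendsto_div_sqrt_neg_one :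
    Tendsto (fun t : ℝ ↦ t / √(1 - t ^ 2)) (𝓝[>] (-1)) atBot := by
  have h1 : Tendsto (fun t : ℝ ↦ -t) (𝓝[>] (-1)) (𝓝[<] 1) := by
    have := tendsto_neg_nhdsGT (a := (-1 : ℝ))
    rwa [neg_neg] at this
  have h2 := tendsto_neg_atTop_atBot.comp (tendsto_div_sqrt_one.comp h1)
  refine h2.congr fun t ↦ ?_
  simp [neg_div]

theorem extIcc_apply {f : ℝ → ℂ} (hf : HasLimits f) {t : ℝ} (ht : t ∈ Ioo (-1 : ℝ) 1) :
    extIcc f t = f (t / √(1 - t ^ 2)) :=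
  extendFrom_extends (hf.continuous.comp_continuousOn continuousOn_div_sqrt) t ht

theorem continuousOn_extIcc {f : ℝ → ℂ} (hf : HasLimits f) :
    ContinuousOn (extIcc f) (Icc (-1) 1) := by
  obtain ⟨a, ha⟩ := hf.atTop
  obtain ⟨b, hb⟩ := hf.atBot
  exact continuousOn_Icc_extendFrom_Ioo
    (hf.continuous.comp_continuousOn continuousOn_div_sqrt)
    (hb.comp tendsto_div_sqrt_neg_one) (ha.comp tendsto_div_sqrt_one)

theorem norm_extIcc_le {f : ℝ → ℂ} (hf : HasLimits f) {c : ℝ} (h : ∀ x, ‖f x‖ ≤ c) {t : ℝ}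
    (ht : t ∈ Icc (-1 : ℝ) 1) : ‖extIcc f t‖ ≤ c := by
  have hcl : closure (Ioo (-1 : ℝ) 1) = Icc (-1) 1 := closure_Ioo (by norm_num)
  refine le_on_closure (f := fun t ↦ ‖extIcc f t‖) (g := fun _ ↦ c) (s := Ioo (-1) 1)
    (fun t ht ↦ ?_) ?_ continuousOn_const (hcl ▸ ht)
  · rw [extIcc_apply hf ht]
    exact h _
  · rw [hcl]
    exact (continuousOn_extIcc hf).norm

variable {A : E →ₗ.[ℂ] E}

theorem spectrum_boundedTransform (hA : IsSelfAdjoint A) {w : ℂ}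
    (hw : w ∈ spectrum ℂ (boundedTransform A)) : w = w.re ∧ w.re ∈ Icc (-1 : ℝ) 1 := by
  refine ⟨(isSelfAdjoint_boundedTransform hA).mem_spectrum_eq_re hw, ?_⟩
  have h1 := spectrum.norm_le_norm_mul_of_mem hw
  have h2 : ‖(1 : E →L[ℂ] E)‖ ≤ 1 := ContinuousLinearMap.norm_id_le
  have h3 := (Complex.abs_re_le_norm w).trans
    (h1.trans (mul_le_one₀ (norm_boundedTransform_le hA) (norm_nonneg _) h2))
  exact abs_le.mp h3

theorem continuousOn_comp_re (hA : IsSelfAdjoint A) {f : ℝ → ℂ}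
    (hf : ContinuousOn f (Icc (-1) 1)) :
    ContinuousOn (fun w : ℂ ↦ f w.re) (spectrum ℂ (boundedTransform A)) :=
  hf.comp Complex.continuous_re.continuousOn fun _ hw ↦ (spectrum_boundedTransform hA hw).2

/-- A continuous extension to `[-1, 1]` is unique, so `fn` can be computed with any convenient one.
The algebraic rules for `fn` are reduced to those of `cfc` in this way. -/
theorem fn_eq_cfc (hA : IsSelfAdjoint A) {f f' : ℝ → ℂ} (hf' : ContinuousOn f' (Icc (-1) 1))
    (h : ∀ t ∈ Ioo (-1 : ℝ) 1, f' t = f (t / √(1 - t ^ 2))) :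
    fn f A = cfc (fun w : ℂ ↦ f' w.re) (boundedTransform A) := by
  refine cfc_congr fun w hw ↦ ?_
  have hm := (spectrum_boundedTransform hA hw).2
  have hcl : closure (Ioo (-1 : ℝ) 1) = Icc (-1) 1 := closure_Ioo (by norm_num)
  refine extendFrom_eq (hcl ▸ hm) ?_
  refine Tendsto.congr' ?_ ((hf' _ hm).mono_left (nhdsWithin_mono _ Ioo_subset_Icc_self))
  filter_upwards [self_mem_nhdsWithin] with t ht using h t ht

theorem fn_add (hA : IsSelfAdjoint A) {f g : ℝ → ℂ} (hf : HasLimits f) (hg : HasLimits g) :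
    fn (fun x ↦ f x + g x) A = fn f A + fn g A := by
  rw [fn_eq_cfc hA (f' := fun t ↦ extIcc f t + extIcc g t)
    ((continuousOn_extIcc hf).add (continuousOn_extIcc hg))
    fun t ht ↦ by rw [extIcc_apply hf ht, extIcc_apply hg ht]]
  exact cfc_add _ _ _ (continuousOn_comp_re hA (continuousOn_extIcc hf))
    (continuousOn_comp_re hA (continuousOn_extIcc hg))

theorem fn_mul (hA : IsSelfAdjoint A) {f g : ℝ → ℂ} (hf : HasLimits f) (hg : HasLimits g) :
    fn (fun x ↦ f x * g x) A = fn f A * fn g A := by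
  rw [fn_eq_cfc hA (f' := fun t ↦ extIcc f t * extIcc g t)
    ((continuousOn_extIcc hf).mul (continuousOn_extIcc hg))
    fun t ht ↦ by rw [extIcc_apply hf ht, extIcc_apply hg ht]]
  exact cfc_mul _ _ _ (continuousOn_comp_re hA (continuousOn_extIcc hf))
    (continuousOn_comp_re hA (continuousOn_extIcc hg))

theorem fn_const (hA : IsSelfAdjoint A) (c : ℂ) :
    fn (fun _ ↦ c) A = c • (1 : E →L[ℂ] E) := by
  have := (isSelfAdjoint_boundedTransform hA).isStarNormal
  rw [fn_eq_cfc hA (f' := fun _ ↦ c) continuousOn_const fun _ _ ↦ rfl, cfc_const c _ this,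
    Algebra.algebraMap_eq_smul_one]

theorem fn_const_mul (hA : IsSelfAdjoint A) {f : ℝ → ℂ} (hf : HasLimits f) (c : ℂ) :
    fn (fun x ↦ c * f x) A = c • fn f A := by
  rw [fn_mul hA (.const c) hf, fn_const hA, smul_mul_assoc, one_mul]

theorem fn_sub (hA : IsSelfAdjoint A) {f g : ℝ → ℂ} (hf : HasLimits f) (hg : HasLimits g) :
    fn (fun x ↦ f x - g x) A = fn f A - fn g A := by
  have h := fn_add hA (hf.sub hg) hg
  simp only [sub_add_cancel] at h
  rw [eq_sub_iff_add_eq, ← h]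

theorem star_fn (hA : IsSelfAdjoint A) {f : ℝ → ℂ} (hf : HasLimits f) :
    star (fn f A) = fn (fun x ↦ conj (f x)) A := by
  rw [fn_eq_cfc hA (f' := fun t ↦ conj (extIcc f t))
    (Complex.continuous_conj.comp_continuousOn (continuousOn_extIcc hf))
    (f := fun x ↦ conj (f x)) fun t ht ↦ by rw [extIcc_apply hf ht]]
  exact (cfc_star (fun w : ℂ ↦ extIcc f w.re) _).symm

theorem norm_fn_le (hA : IsSelfAdjoint A) {f : ℝ → ℂ} (hf : HasLimits f) {c : ℝ}
    (h : ∀ x, ‖f x‖ ≤ c) : ‖fn f A‖ ≤ c :=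
  norm_cfc_le ((norm_nonneg _).trans (h 0)) fun _ hw ↦
    norm_extIcc_le hf h (spectrum_boundedTransform hA hw).2

/-! ### The resolvent as a function of the operator, and norm estimates. -/

/-- The function `t ↦ √(1 - t²)`, which corresponds to `x ↦ (1 + x²)^{-1/2}`. -/
def sqrtOneSubSq (t : ℝ) : ℂ := (√(1 - t ^ 2) : ℝ)

theorem continuous_sqrtOneSubSq : Continuous sqrtOneSubSq := by
  unfold sqrtOneSubSq
  fun_prop

theorem sqrtOneSubSq_mul_self {t : ℝ} (ht : t ∈ Icc (-1 : ℝ) 1) :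
    sqrtOneSubSq t * sqrtOneSubSq t = 1 - t * t := by
  have h : (0 : ℝ) ≤ 1 - t ^ 2 := by nlinarith [ht.1, ht.2]
  rw [sqrtOneSubSq, ← Complex.ofReal_mul, Real.mul_self_sqrt h]
  push_cast
  ring

theorem cfc_ofReal_re (hA : IsSelfAdjoint A) :
    cfc (fun w : ℂ ↦ (w.re : ℂ)) (boundedTransform A) = boundedTransform A := by
  have := (isSelfAdjoint_boundedTransform hA).isStarNormal
  conv_rhs => rw [← cfc_id' ℂ (boundedTransform A)]
  exact cfc_congr fun w hw ↦ (spectrum_boundedTransform hA hw).1.symm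

open scoped ComplexOrder in
-- Uniqueness of the positive square root: both sides are nonnegative with square `1 - Z²`, where
-- `Z` is the bounded transform.
theorem invSqrtOneAddSq_eq_cfc (hA : IsSelfAdjoint A) :
    invSqrtOneAddSq A = cfc (fun w : ℂ ↦ sqrtOneSubSq w.re) (boundedTransform A) := by
  have hn := (isSelfAdjoint_boundedTransform hA).isStarNormal
  have hs := continuousOn_comp_re hA continuous_sqrtOneSubSq.continuousOn
  have hr := continuousOn_comp_re hA Complex.continuous_ofReal.continuousOn
  rw [invSqrtOneAddSq]
  refine CFC.sqrt_unique ?_ (cfc_nonneg fun w _ ↦ ?_)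
  · rw [← invSqrtOneAddSq_mul_self hA, ← cfc_mul _ _ _ hs hs,
      eq_sub_iff_add_eq.mpr ((add_comm _ _).trans
        (eq_sub_iff_add_eq.mp (boundedTransform_mul_self hA)))]
    nth_rewrite 2 3 [← cfc_ofReal_re hA]
    rw [← cfc_mul _ _ _ hr hr, ← cfc_const_one ℂ (boundedTransform A),
      ← cfc_sub (fun _ ↦ 1) (fun w : ℂ ↦ (w.re : ℂ) * w.re) _ continuousOn_const (hr.mul hr)]
    exact cfc_congr fun w hw ↦ sqrtOneSubSq_mul_self (spectrum_boundedTransform hA hw).2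
  · exact Complex.zero_le_real.mpr (Real.sqrt_nonneg _)

theorem ofReal_sub_mul_sqrtOneSubSq_ne_zero {z : ℂ} (hz : z.im ≠ 0) (t : ℝ) :
    (t : ℂ) - z * sqrtOneSubSq t ≠ 0 := by
  intro h
  have him := congrArg Complex.im h
  rw [sqrtOneSubSq, Complex.sub_im, Complex.im_mul_ofReal, Complex.ofReal_im, zero_sub,
    Complex.zero_im, neg_eq_zero] at him
  have hs := (mul_eq_zero.mp him).resolve_left hz
  rw [sqrtOneSubSq, hs, Complex.ofReal_zero, mul_zero, sub_zero, Complex.ofReal_eq_zero] at h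
  rw [h] at hs
  norm_num at hs

/-- With `s = √(1 - t²)` and `x = t / s`, one has `(x - z)⁻¹ = s (t - z s)⁻¹`, whose denominator
vanishes nowhere. This matches `(A - z)⁻¹ (Z - z S) = S` for the bounded transform `Z` and `S = (I +
A²)^{-1/2}`. -/
theorem fn_inv_sub (hA : IsSelfAdjoint A) {z : ℂ} (hz : z.im ≠ 0) :
    fn (fun x ↦ ((x : ℂ) - z)⁻¹) A = res A z := by
  have hn := (isSelfAdjoint_boundedTransform hA).isStarNormal
  have hd := ofReal_sub_mul_sqrtOneSubSq_ne_zero hz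
  have hs := continuous_sqrtOneSubSq
  have hD : Continuous fun t : ℝ ↦ (t : ℂ) - z * sqrtOneSubSq t := by fun_prop
  have hD' : Continuous fun t : ℝ ↦ ((t : ℂ) - z * sqrtOneSubSq t)⁻¹ := hD.inv₀ hd
  rw [fn_eq_cfc hA (f' := fun t ↦ sqrtOneSubSq t * ((t : ℂ) - z * sqrtOneSubSq t)⁻¹)
    (hs.mul hD').continuousOn ?_]
  · have h1 : boundedTransform A - z • invSqrtOneAddSq A =
        cfc (fun w : ℂ ↦ (w.re : ℂ) - z * sqrtOneSubSq w.re) (boundedTransform A) := by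
      rw [cfc_sub _ _ _ (by fun_prop) (by fun_prop), cfc_const_mul _ _ _ (by fun_prop),
        cfc_ofReal_re hA, invSqrtOneAddSq_eq_cfc hA]
    have h2 := res_mul_boundedTransform_sub hA hz
    rw [cfc_mul _ _ _ (continuousOn_comp_re hA hs.continuousOn)
      (continuousOn_comp_re hA hD'.continuousOn), ← invSqrtOneAddSq_eq_cfc hA, ← h2, h1, mul_assoc,
      ← cfc_mul _ _ _ (continuousOn_comp_re hA hD.continuousOn)
      (continuousOn_comp_re hA hD'.continuousOn)]
    simp only [mul_inv_cancel₀ (hd _)]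
    rw [cfc_const_one ℂ (boundedTransform A), mul_one]
  · intro t ht
    have hp := Real.sqrt_pos.mpr (one_sub_sq_pos ht)
    have hp' : ((√(1 - t ^ 2) : ℝ) : ℂ) ≠ 0 := Complex.ofReal_ne_zero.mpr hp.ne'
    have := hd t
    rw [sqrtOneSubSq] at this ⊢
    rw [Complex.ofReal_div, div_sub' hp', inv_div, div_eq_mul_inv, mul_comm z]

theorem fn_mul_invSqrtOneAddSq_norm_le (hA : IsSelfAdjoint A) {f : ℝ → ℂ} (hf : HasLimits f)
    {c : ℝ} (h : ∀ x, ‖f x‖ ≤ c * √(1 + x ^ 2)) : ‖fn f A * invSqrtOneAddSq A‖ ≤ c := by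
  have hs := continuous_sqrtOneSubSq
  have hc : 0 ≤ c := by simpa using (norm_nonneg _).trans (h 0)
  rw [invSqrtOneAddSq_eq_cfc hA]
  change ‖cfc (fun w : ℂ ↦ extIcc f w.re) _ * _‖ ≤ c
  rw [← cfc_mul _ _ _ (continuousOn_comp_re hA (continuousOn_extIcc hf))
    (continuousOn_comp_re hA hs.continuousOn)]
  refine norm_cfc_le hc fun w hw ↦ ?_
  have hcl : closure (Ioo (-1 : ℝ) 1) = Icc (-1) 1 := closure_Ioo (by norm_num)
  refine le_on_closure (f := fun t ↦ ‖extIcc f t * sqrtOneSubSq t‖) (g := fun _ ↦ c)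
    (s := Ioo (-1) 1) (fun t ht ↦ ?_) ?_ continuousOn_const
    (hcl ▸ (spectrum_boundedTransform hA hw).2)
  · have hp := one_sub_sq_pos ht
    have hp' := Real.sqrt_pos.mpr hp
    have e : √(1 + (t / √(1 - t ^ 2)) ^ 2) = (√(1 - t ^ 2))⁻¹ := by
      rw [div_pow, Real.sq_sqrt hp.le, ← Real.sqrt_inv]
      congr 1
      field_simp
      ring
    have h1 := h (t / √(1 - t ^ 2))
    rw [e, ← div_eq_mul_inv, le_div_iff₀ hp'] at h1
    show ‖extIcc f t * sqrtOneSubSq t‖ ≤ c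
    rw [extIcc_apply hf ht, norm_mul, sqrtOneSubSq, Complex.norm_of_nonneg hp'.le]
    exact h1
  · rw [hcl]
    exact ((continuousOn_extIcc hf).mul hs.continuousOn).norm

/-- Strong convergence to zero of functions of a self-adjoint operator. -/
theorem tendsto_fn_apply (hA : IsSelfAdjoint A) {ι : Type*} {l : Filter ι} {f : ι → ℝ → ℂ}
    (hf : ∀ᶠ i in l, HasLimits (f i)) {c : ℝ} (hc : ∀ᶠ i in l, ∀ x, ‖f i x‖ ≤ c) {b : ι → ℝ}
    (hb : Tendsto b l (𝓝 0)) (hfb : ∀ᶠ i in l, ∀ x, ‖f i x‖ ≤ b i * √(1 + x ^ 2)) (v : E) :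
    Tendsto (fun i ↦ fn (f i) A v) l (𝓝 0) := by
  rw [Metric.tendsto_nhds]
  intro ε hε
  -- Approximate `v` by a vector in the range of `(I + A²)^{-1/2}`. There the weighted bound `b i`
  -- tends to zero, and the uniform bound `c` controls the error.
  obtain ⟨w, hw⟩ := (denseRange_invSqrtOneAddSq hA).exists_dist_lt v
    (show 0 < ε / 2 / (|c| + 1) by positivity)
  have h1 : Tendsto (fun i ↦ b i * ‖w‖) l (𝓝 0) := by simpa using hb.mul_const ‖w‖
  filter_upwards [hf, hc, hfb, h1.eventually_lt_const (half_pos hε)] with i h2 h3 h4 h5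
  have h6 : ‖fn (f i) A (v - invSqrtOneAddSq A w)‖ ≤ |c| * ‖v - invSqrtOneAddSq A w‖ :=
    (fn (f i) A).le_of_opNorm_le ((norm_fn_le hA h2 h3).trans (le_abs_self c)) _
  have h7 : ‖fn (f i) A (invSqrtOneAddSq A w)‖ ≤ b i * ‖w‖ :=
    (fn (f i) A * invSqrtOneAddSq A).le_of_opNorm_le
      (fn_mul_invSqrtOneAddSq_norm_le hA h2 h4) _
  rw [dist_eq_norm, lt_div_iff₀ (by positivity)] at hw
  rw [dist_zero_right]
  calc ‖fn (f i) A v‖ = ‖fn (f i) A (v - invSqrtOneAddSq A w) + fn (f i) A (invSqrtOneAddSq A w)‖ := by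
        rw [← map_add, sub_add_cancel]
    _ ≤ |c| * ‖v - invSqrtOneAddSq A w‖ + b i * ‖w‖ := (norm_add_le _ _).trans (add_le_add h6 h7)
    _ < ε := by nlinarith [norm_nonneg (v - invSqrtOneAddSq A w)]

/-- Differentiability in norm of a family of functions of a self-adjoint operator. -/
theorem hasDerivAt_fn (hA : IsSelfAdjoint A) {f : ℝ → ℝ → ℂ} {f' : ℝ → ℂ} {y₀ c : ℝ}
    (hf : ∀ᶠ y in 𝓝 y₀, HasLimits (f y)) (hf' : HasLimits f')
    (h : ∀ᶠ y in 𝓝 y₀, ∀ x, ‖f y x - f y₀ x - ((y - y₀ : ℝ) : ℂ) * f' x‖ ≤ c * (y - y₀) ^ 2) :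
    HasDerivAt (fun y ↦ fn (f y) A) (fn f' A) y₀ := by
  rw [hasDerivAt_iff_isLittleO]
  refine Asymptotics.IsBigO.trans_isLittleO (Asymptotics.IsBigO.of_bound c ?_)
    (Asymptotics.isLittleO_pow_sub_sub y₀ one_lt_two)
  filter_upwards [hf, h] with y h1 h2
  have h0 := hf.self_of_nhds
  rw [← Complex.coe_smul, ← fn_const_mul hA hf', ← fn_sub hA h1 h0,
    ← fn_sub hA (h1.sub h0) (hf'.const_mul _), norm_pow, norm_norm, Real.norm_eq_abs, sq_abs]
  exact norm_fn_le hA ((h1.sub h0).sub (hf'.const_mul _)) h2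

theorem re_inner_fn_eq (hA : IsSelfAdjoint A) {k : ℝ → ℝ} (hk : HasLimits fun x ↦ (k x : ℂ))
    (h : ∀ x, 0 ≤ k x) (v : E) :
    (⟪v, fn (fun x ↦ (k x : ℂ)) A v⟫_ℂ).re = ‖fn (fun x ↦ (√(k x) : ℂ)) A v‖ ^ 2 := by
  have h1 : HasLimits fun x ↦ ((√(k x) : ℝ) : ℂ) :=
    hk.comp (φ := fun w ↦ ((√w.re : ℝ) : ℂ)) (by fun_prop)
  have h2 := fn_mul hA h1 h1
  have h3 := star_fn hA h1
  simp only [Complex.conj_ofReal] at h3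
  simp only [← Complex.ofReal_mul, Real.mul_self_sqrt (h _)] at h2
  rw [h2]
  nth_rewrite 1 [← h3]
  rw [inner_star_mul]
  norm_cast

theorem re_inner_fn_mono (hA : IsSelfAdjoint A) {k k' : ℝ → ℝ}
    (hk : HasLimits fun x ↦ (k x : ℂ)) (hk' : HasLimits fun x ↦ (k' x : ℂ))
    (h : ∀ x, k x ≤ k' x) (v : E) :
    (⟪v, fn (fun x ↦ (k x : ℂ)) A v⟫_ℂ).re ≤ (⟪v, fn (fun x ↦ (k' x : ℂ)) A v⟫_ℂ).re := by
  have h1 := re_inner_fn_eq hA (k := fun x ↦ k' x - k x)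
    (by simpa only [Complex.ofReal_sub] using hk'.sub hk) (fun x ↦ sub_nonneg.mpr (h x)) v
  simp only [Complex.ofReal_sub] at h1
  rw [fn_sub hA hk' hk, sub_apply, inner_sub_right, Complex.sub_re] at h1
  nlinarith [sq_nonneg ‖fn (fun x ↦ ((√(k' x - k x) : ℝ) : ℂ)) A v‖]

theorem norm_fn_apply_sq (hA : IsSelfAdjoint A) {f : ℝ → ℂ} (hf : HasLimits f) (v : E) :
    ‖fn f A v‖ ^ 2 = (⟪v, fn (fun x ↦ ((‖f x‖ ^ 2 : ℝ) : ℂ)) A v⟫_ℂ).re := by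
  have h1 := fn_mul hA (hf.comp Complex.continuous_conj) hf
  rw [← star_fn hA hf] at h1
  have e : (fun x ↦ ((‖f x‖ ^ 2 : ℝ) : ℂ)) = fun x ↦ conj (f x) * f x := by
    ext x
    rw [Complex.conj_mul']
    push_cast
    rfl
  rw [e, h1, inner_star_mul]
  norm_cast

end FunctionalCalculus

/-! ### Some functions with limits at infinity -/

section Functions

theorem HasLimits.of_tendsto_zero {f : ℝ → ℂ} (hc : Continuous f)
    (h : Tendsto f (cocompact ℝ) (𝓝 0)) : HasLimits f := by
  rw [cocompact_eq_atBot_atTop, tendsto_sup] at h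
  exact ⟨hc, ⟨0, h.2⟩, ⟨0, h.1⟩⟩

theorem ofReal_sub_ne_zero {z : ℂ} (hz : z.im ≠ 0) (x : ℝ) : (x : ℂ) - z ≠ 0 := by
  intro h
  have := congrArg Complex.im h
  simp at this
  exact hz this

theorem tendsto_abs_cocompact : Tendsto (fun x : ℝ ↦ |x|) (cocompact ℝ) atTop :=
  tendsto_norm_cocompact_atTop

theorem hasLimits_inv_sub {z : ℂ} (hz : z.im ≠ 0) : HasLimits fun x ↦ ((x : ℂ) - z)⁻¹ := by
  refine .of_tendsto_zero (Continuous.inv₀ (by fun_prop) (ofReal_sub_ne_zero hz)) ?_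
  rw [tendsto_zero_iff_norm_tendsto_zero]
  simp only [norm_inv]
  refine tendsto_inv_atTop_zero.comp ?_
  refine tendsto_atTop_mono (f := fun x : ℝ ↦ |x| - ‖z‖) (fun x ↦ ?_)
    (tendsto_atTop_add_const_right _ _ tendsto_abs_cocompact)
  simpa using norm_sub_norm_le (x : ℂ) z

theorem hasLimits_inv_abs_add {r : ℝ} (hr : 0 < r) :
    HasLimits fun x ↦ (((|x| + r)⁻¹ : ℝ) : ℂ) := by
  refine .of_tendsto_zero (Complex.continuous_ofReal.comp
    (Continuous.inv₀ (by fun_prop) fun x ↦ by positivity)) ?_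
  rw [← Complex.ofReal_zero]
  exact (Complex.continuous_ofReal.tendsto 0).comp (tendsto_inv_atTop_zero.comp
    (tendsto_atTop_add_const_right _ _ tendsto_abs_cocompact))

theorem hasLimits_inv_sqrt_abs_add_one :
    HasLimits fun x ↦ ((1 / √(|x| + 1) : ℝ) : ℂ) := by
  have h := (hasLimits_inv_abs_add one_pos).comp (φ := fun w ↦ ((√w.re : ℝ) : ℂ)) (by fun_prop)
  simpa only [Complex.ofReal_re, Real.sqrt_inv, one_div] using h

/-- On each half-line the function is a constant plus a multiple of `(x - z)⁻¹`; the constants are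
`1` and `-1`, so the limits at the two ends differ. -/
theorem hasLimits_abs_add_one_div_sub {z : ℂ} (hz : z.im ≠ 0) :
    HasLimits fun x ↦ ((|x| + 1 : ℝ) : ℂ) / ((x : ℂ) - z) := by
  have hr := hasLimits_inv_sub hz
  have h0 := ofReal_sub_ne_zero hz
  refine ⟨Continuous.div (by fun_prop) (by fun_prop) h0, ?_, ?_⟩
  · obtain ⟨a, ha⟩ := ((HasLimits.const 1).add (hr.const_mul (1 + z))).atTop
    refine ⟨a, ha.congr' ?_⟩
    filter_upwards [eventually_ge_atTop 0] with x hx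
    have := h0 x
    rw [abs_of_nonneg hx]
    push_cast
    field_simp
    ring
  · obtain ⟨a, ha⟩ := ((HasLimits.const (-1)).add (hr.const_mul (1 - z))).atBot
    refine ⟨a, ha.congr' ?_⟩
    filter_upwards [eventually_le_atBot 0] with x hx
    have := h0 x
    rw [abs_of_nonpos hx]
    push_cast
    field_simp
    ring

theorem sqrt_mul_inv_eq (z : ℂ) (x : ℝ) :
    ((√(|x| + 1) : ℝ) : ℂ) * ((x : ℂ) - z)⁻¹ =
      ((|x| + 1 : ℝ) : ℂ) / ((x : ℂ) - z) * ((1 / √(|x| + 1) : ℝ) : ℂ) := by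
  have h : (0 : ℝ) ≤ |x| + 1 := by positivity
  nth_rewrite 2 [← Real.mul_self_sqrt h]
  have h' : ((√(|x| + 1) : ℝ) : ℂ) ≠ 0 :=
    Complex.ofReal_ne_zero.mpr (Real.sqrt_pos.mpr (by positivity)).ne'
  push_cast
  field_simp

theorem hasLimits_sqrt_mul_inv {z : ℂ} (hz : z.im ≠ 0) :
    HasLimits fun x ↦ ((√(|x| + 1) : ℝ) : ℂ) * ((x : ℂ) - z)⁻¹ := by
  simp only [sqrt_mul_inv_eq]
  exact (hasLimits_abs_add_one_div_sub hz).mul hasLimits_inv_sqrt_abs_add_one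

/-! ### Cut-off and weight functions. -/

/-- The cut-off function `R / (|x| + R)`. -/
def cutoff (R x : ℝ) : ℝ := R * (|x| + R)⁻¹

theorem hasLimits_cutoff {R : ℝ} (hR : 0 < R) : HasLimits fun x ↦ (cutoff R x : ℂ) := by
  simp only [cutoff, Complex.ofReal_mul]
  exact (hasLimits_inv_abs_add hR).const_mul _

theorem cutoff_nonneg {R : ℝ} (hR : 0 < R) (x : ℝ) : 0 ≤ cutoff R x := by
  unfold cutoff
  positivity

theorem one_sub_cutoff {R : ℝ} (hR : 0 < R) (x : ℝ) : 1 - cutoff R x = |x| * (|x| + R)⁻¹ := by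
  have : |x| + R ≠ 0 := by positivity
  unfold cutoff
  field_simp
  ring

theorem cutoff_le_one {R : ℝ} (hR : 0 < R) (x : ℝ) : cutoff R x ≤ 1 := by
  have h := one_sub_cutoff hR x
  have : 0 ≤ |x| * (|x| + R)⁻¹ := by positivity
  linarith

theorem abs_one_sub_cutoff_le_one {R : ℝ} (hR : 0 < R) (x : ℝ) : |1 - cutoff R x| ≤ 1 := by
  rw [abs_le]
  constructor <;> linarith [cutoff_le_one hR x, cutoff_nonneg hR x]

theorem abs_one_sub_cutoff_le {R : ℝ} (hR : 0 < R) (x : ℝ) :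
    |1 - cutoff R x| ≤ R⁻¹ * √(1 + x ^ 2) := by
  rw [one_sub_cutoff hR, abs_of_nonneg (by positivity), mul_comm]
  refine mul_le_mul ?_ ?_ (abs_nonneg x) (by positivity)
  · exact inv_anti₀ hR (by linarith [abs_nonneg x])
  · exact Real.abs_le_sqrt (by linarith)

theorem cutoff_mul_le {R : ℝ} (hR : 1 ≤ R) (x : ℝ) : cutoff R x * (|x| + 1) ≤ R := by
  have h : 0 < |x| + R := by positivity
  rw [cutoff, mul_assoc, inv_mul_eq_div]
  exact mul_le_of_le_one_right (by linarith) ((div_le_one h).mpr (by linarith))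

/-- The function `(|x| + 1) / (|x| + y)`. -/
def weight (y x : ℝ) : ℝ := (|x| + 1) * (|x| + y)⁻¹

theorem weight_eq {y : ℝ} (hy : 0 < y) (x : ℝ) :
    weight y x = 1 - (y - 1) * (|x| + y)⁻¹ := by
  have : |x| + y ≠ 0 := by positivity
  unfold weight
  field_simp
  ring

theorem hasLimits_weight {y : ℝ} (hy : 0 < y) : HasLimits fun x ↦ (weight y x : ℂ) := by
  simp only [weight_eq hy]
  push_cast
  have h := (HasLimits.const 1).sub ((hasLimits_inv_abs_add hy).const_mul ((y : ℂ) - 1))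
  push_cast at h
  exact h

theorem weight_nonneg {y : ℝ} (hy : 0 < y) (x : ℝ) : 0 ≤ weight y x := by
  unfold weight
  positivity

theorem weight_le_one {y : ℝ} (hy : 1 ≤ y) (x : ℝ) : weight y x ≤ 1 := by
  have : 0 < |x| + y := by positivity
  rw [weight, ← div_eq_mul_inv, div_le_one this]
  linarith

theorem cutoff_mul_weight_le {R y : ℝ} (hR : 1 ≤ R) (hy : 0 < y) (x : ℝ) :
    cutoff R x * weight y x ≤ R / y := by
  rw [weight, ← mul_assoc, div_eq_mul_inv]
  exact mul_le_mul (cutoff_mul_le hR x) (inv_anti₀ hy (by linarith [abs_nonneg x]))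
    (by positivity) (by linarith)

/-- Minus the derivative of `weight y x` with respect to `y`. -/
def weightDeriv (y x : ℝ) : ℝ := weight y x * (|x| + y)⁻¹

theorem hasLimits_weightDeriv {y : ℝ} (hy : 0 < y) :
    HasLimits fun x ↦ (weightDeriv y x : ℂ) := by
  simp only [weightDeriv, Complex.ofReal_mul]
  exact (hasLimits_weight hy).mul (hasLimits_inv_abs_add hy)

/-- The remainder equals `weight y₀ x * (y - y₀)² / ((|x| + y) (|x| + y₀))`. Its uniformity in `x`
is what gives differentiability in operator norm. -/
theorem abs_weight_sub_le {y y₀ : ℝ} (hy : 1 / 2 ≤ y) (hy₀ : 1 ≤ y₀) (x : ℝ) :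
    |weight y x - weight y₀ x - (y - y₀) * -weightDeriv y₀ x| ≤ 2 * (y - y₀) ^ 2 := by
  have h1 : 0 < |x| + y := by positivity
  have h2 : 0 < |x| + y₀ := by positivity
  have e : weight y x - weight y₀ x - (y - y₀) * -weightDeriv y₀ x =
      (weight y₀ x * ((|x| + y)⁻¹ * (|x| + y₀)⁻¹) * (|x| + y₀)) * (|x| + y₀)⁻¹ * (y - y₀) ^ 2 := by
    unfold weightDeriv weight
    field_simp
    ring
  have h3 := weight_le_one hy₀ x
  have h4 := weight_nonneg (by linarith : 0 < y₀) x
  have h5 : (|x| + y)⁻¹ ≤ 2 := by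
    rw [inv_le_comm₀ h1 two_pos]
    linarith [abs_nonneg x]
  have h6 : (|x| + y₀)⁻¹ ≤ 1 := inv_le_one_of_one_le₀ (by linarith [abs_nonneg x])
  rw [e, mul_assoc _ (|x| + y₀), mul_inv_cancel₀ h2.ne', mul_one, abs_of_nonneg (by positivity)]
  refine mul_le_mul_of_nonneg_right ?_ (sq_nonneg _)
  calc weight y₀ x * ((|x| + y)⁻¹ * (|x| + y₀)⁻¹) ≤ 1 * (2 * 1) := by gcongr
    _ = 2 := by norm_num

/-! ### Pointwise resolvent bounds in the sector `2 |Re z| ≤ |Im z|`. -/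

theorem norm_ofReal_sub_sq (z : ℂ) (x : ℝ) :
    ‖(x : ℂ) - z‖ ^ 2 = (x - z.re) ^ 2 + z.im ^ 2 := by
  rw [Complex.sq_norm, Complex.normSq_apply]
  simp
  ring

/-- Here `|x| + y ≤ a + (3/2) y` with `a = |x - Re z|`, and the square of the right side is at most
`2 a² + (9/2) y²`; hence the constant `5`. -/
theorem abs_add_sq_le {z : ℂ} {y : ℝ} (hy : |z.im| = y) (hz : 2 * |z.re| ≤ y) (x : ℝ) :
    (|x| + y) ^ 2 ≤ 5 * ‖(x : ℂ) - z‖ ^ 2 := by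
  have h1 : |x| ≤ |x - z.re| + |z.re| := by
    simpa using abs_add_le (x - z.re) z.re
  rw [norm_ofReal_sub_sq, ← sq_abs (x - z.re), ← sq_abs z.im, hy]
  have h2 : |x| + y ≤ |x - z.re| + 3 / 2 * y := by linarith
  have h3 : 0 ≤ |x| + y := by rw [← hy]; positivity
  nlinarith [pow_le_pow_left₀ h3 h2 2, sq_nonneg (|x - z.re| - 3 / 2 * y), sq_nonneg y]

theorem norm_abs_add_one_div_sub_le {z : ℂ} {y : ℝ} (hy : |z.im| = y) (hy0 : 0 < y)
    (hz : 2 * |z.re| ≤ y) (x : ℝ) :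
    ‖((|x| + 1 : ℝ) : ℂ) / ((x : ℂ) - z)‖ ≤ 3 * weight y x := by
  have hz' : z.im ≠ 0 := abs_pos.mp (hy ▸ hy0)
  have h0 : 0 < ‖(x : ℂ) - z‖ := norm_pos_iff.mpr (ofReal_sub_ne_zero hz' x)
  have h1 : |x| + y ≤ 3 * ‖(x : ℂ) - z‖ := by
    refine abs_le_of_sq_le_sq' ?_ (by positivity) |>.2
    nlinarith [abs_add_sq_le hy hz x]
  have h2 : 0 < |x| + y := by positivity
  rw [norm_div, Complex.norm_of_nonneg (by positivity), weight, ← div_eq_mul_inv, ← mul_div_assoc,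
    div_le_div_iff₀ h0 h2]
  nlinarith [mul_le_mul_of_nonneg_left h1 (show 0 ≤ |x| + 1 by positivity)]

theorem norm_sqrt_mul_inv_sq_le {z : ℂ} {y : ℝ} (hy : |z.im| = y) (hy0 : 0 < y)
    (hz : 2 * |z.re| ≤ y) (x : ℝ) :
    ‖((√(|x| + 1) : ℝ) : ℂ) * ((x : ℂ) - z)⁻¹‖ ^ 2 ≤ 5 * weightDeriv y x := by
  have hz' : z.im ≠ 0 := abs_pos.mp (hy ▸ hy0)
  have h0 : 0 < ‖(x : ℂ) - z‖ := norm_pos_iff.mpr (ofReal_sub_ne_zero hz' x)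
  have h1 := abs_add_sq_le hy hz x
  have h2 : 0 < |x| + y := by positivity
  have h3 : 0 < |x| + 1 := by positivity
  rw [norm_mul, Complex.norm_of_nonneg (Real.sqrt_nonneg _), norm_inv, mul_pow,
    Real.sq_sqrt h3.le, weightDeriv, weight, mul_assoc, ← sq, inv_pow, inv_pow,
    ← div_eq_mul_inv, ← div_eq_mul_inv, ← mul_div_assoc, div_le_div_iff₀ (by positivity)
    (by positivity)]
  nlinarith [mul_le_mul_of_nonneg_left h1 h3.le]

/-! ### The argument as an arctangent, and its derivative in `y`. -/

/-- `arctan ((x - l) / y)`. -/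
def arctanDiv (l y x : ℝ) : ℂ := (Real.arctan ((x - l) / y) : ℝ)

theorem hasLimits_arctanDiv (l : ℝ) {y : ℝ} (hy : 0 < y) : HasLimits (arctanDiv l y) := by
  have h1 : Tendsto (fun x : ℝ ↦ (x - l) / y) atTop atTop :=
    (tendsto_atTop_add_const_right _ (-l) tendsto_id).atTop_div_const hy
  have h2 : Tendsto (fun x : ℝ ↦ (x - l) / y) atBot atBot :=
    (tendsto_atBot_add_const_right _ (-l) tendsto_id).atBot_div_const hy
  refine ⟨Complex.continuous_ofReal.comp (Real.continuous_arctan.comp (by fun_prop)), ?_, ?_⟩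
  · exact ⟨_, (Complex.continuous_ofReal.tendsto _).comp
      ((Real.tendsto_arctan_atTop.mono_right nhdsWithin_le_nhds).comp h1)⟩
  · exact ⟨_, (Complex.continuous_ofReal.tendsto _).comp
      ((Real.tendsto_arctan_atBot.mono_right nhdsWithin_le_nhds).comp h2)⟩

theorem abs_arctan_le_abs (s : ℝ) : |Real.arctan s| ≤ |s| := by
  have h : ∀ s : ℝ, 0 ≤ s → |Real.arctan s| ≤ |s| := fun s hs ↦ by
    rw [abs_of_nonneg hs, abs_of_nonneg (Real.arctan_nonneg.mpr hs)]
    simpa using Real.le_tan (Real.arctan_nonneg.mpr hs) (Real.arctan_lt_pi_div_two s)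
  rcases le_total 0 s with hs | hs
  · exact h s hs
  · simpa using h (-s) (by linarith)

theorem norm_arctanDiv_le (l y x : ℝ) : ‖arctanDiv l y x‖ ≤ 2 := by
  rw [arctanDiv, Complex.norm_real, Real.norm_eq_abs, abs_le]
  constructor <;> linarith [Real.arctan_lt_pi_div_two ((x - l) / y),
    Real.neg_pi_div_two_lt_arctan ((x - l) / y), Real.pi_lt_four]

theorem norm_arctanDiv_le_mul (l : ℝ) {y : ℝ} (hy : 0 < y) (x : ℝ) :
    ‖arctanDiv l y x‖ ≤ (1 + |l|) / y * √(1 + x ^ 2) := by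
  rw [arctanDiv, Complex.norm_real, Real.norm_eq_abs]
  refine (abs_arctan_le_abs _).trans ?_
  rw [abs_div, abs_of_pos hy, div_mul_eq_mul_div]
  gcongr
  have h1 : |x| ≤ √(1 + x ^ 2) := Real.abs_le_sqrt (by linarith)
  have h2 : 1 ≤ √(1 + x ^ 2) := Real.one_le_sqrt.mpr (by nlinarith [sq_nonneg x])
  nlinarith [abs_sub x l, abs_nonneg l]

/-- Polar form: with `s = (x - Re z) / Im z`, the number `x - z` has modulus `Im z √(1 + s²)` and
angle `arctan s - π / 2`, which lies in `(-π, 0)`. -/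
theorem arg_ofReal_sub {z : ℂ} (hz : 0 < z.im) (x : ℝ) :
    ((Complex.arg ((x : ℂ) - z) : ℝ) : ℂ) = arctanDiv z.re z.im x - ((Real.pi / 2 : ℝ) : ℂ) := by
  rw [arctanDiv, ← Complex.ofReal_sub]
  congr 1
  set s := (x - z.re) / z.im with hs
  have h0 : 0 < √(1 + s ^ 2) := Real.sqrt_pos.mpr (by positivity)
  have hm : Real.arctan s - Real.pi / 2 ∈ Ioc (-Real.pi) Real.pi := by
    constructor <;> linarith [Real.arctan_lt_pi_div_two s, Real.neg_pi_div_two_lt_arctan s,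
      Real.pi_pos]
  rw [← Complex.arg_mul_cos_add_sin_mul_I (mul_pos hz h0) hm]
  congr 1
  rw [← Complex.ofReal_cos, ← Complex.ofReal_sin, Real.cos_sub_pi_div_two,
    Real.sin_sub_pi_div_two, Real.cos_arctan, Real.sin_arctan]
  apply Complex.ext
  · simp
    field_simp
    rw [hs]
    field_simp
  · simp
    field_simp

/-- The derivative of `arctan ((x - l) / y)` with respect to `y`, where `z = l + i y`. -/
def arctanDeriv (z : ℂ) (x : ℝ) : ℂ :=
  -(1 / 2 : ℂ) * (((x : ℂ) - z)⁻¹ + ((x : ℂ) - conj z)⁻¹)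

theorem hasLimits_arctanDeriv {z : ℂ} (hz : z.im ≠ 0) : HasLimits (arctanDeriv z) :=
  ((hasLimits_inv_sub hz).add (hasLimits_inv_sub (by simpa using hz))).const_mul _

theorem arctanDeriv_eq (z : ℂ) (x : ℝ) :
    arctanDeriv z x = ((-(((x : ℂ) - z)⁻¹).re : ℝ) : ℂ) := by
  have h : ((x : ℂ) - conj z)⁻¹ = conj (((x : ℂ) - z)⁻¹) := by
    rw [map_inv₀, map_sub, Complex.conj_ofReal]
  rw [arctanDeriv, h, Complex.add_conj]
  push_cast
  ring

theorem hasDerivAt_arctan_div (l x : ℝ) {y : ℝ} (hy : 0 < y) :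
    HasDerivAt (fun y ↦ Real.arctan ((x - l) / y))
      (-(((x : ℂ) - (l + y * Complex.I))⁻¹).re) y := by
  have h : HasDerivAt (fun y ↦ Real.arctan ((x - l) / y)) _ y :=
    ((hasDerivAt_const y (x - l)).div (hasDerivAt_id y) hy.ne').arctan
  refine h.congr_deriv ?_
  rw [Complex.inv_re, Complex.normSq_apply]
  simp
  have : (x - l) * (x - l) + y * y ≠ 0 :=
    (add_pos_of_nonneg_of_pos (mul_self_nonneg _) (mul_pos hy hy)).ne'
  field_simp
  ring

theorem norm_inv_sub_inv_sub_le {l x y y₀ : ℝ} (hy₀ : 0 < y₀) (hy : y₀ / 2 ≤ y) :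
    ‖((x : ℂ) - (l + y * Complex.I))⁻¹ - ((x : ℂ) - (l + y₀ * Complex.I))⁻¹‖ ≤
      2 / y₀ ^ 2 * |y - y₀| := by
  have hy0 : 0 < y := by linarith
  have key : ∀ y : ℝ, 0 < y → y ≤ ‖(x : ℂ) - (l + y * Complex.I)‖ := fun y hy ↦ by
    have := Complex.abs_im_le_norm ((x : ℂ) - (l + y * Complex.I))
    simpa [abs_of_pos hy] using this
  have h1 := key y hy0
  have h2 := key y₀ hy₀
  have n1 : (x : ℂ) - (l + y * Complex.I) ≠ 0 := norm_pos_iff.mp (by linarith)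
  have n2 : (x : ℂ) - (l + y₀ * Complex.I) ≠ 0 := norm_pos_iff.mp (by linarith)
  have e : ((x : ℂ) - (l + y₀ * Complex.I)) - ((x : ℂ) - (l + y * Complex.I)) =
      ((y - y₀ : ℝ) : ℂ) * Complex.I := by push_cast; ring
  rw [inv_sub_inv n1 n2, e, norm_div, norm_mul, norm_mul, Complex.norm_I, mul_one,
    Complex.norm_real, Real.norm_eq_abs, div_le_iff₀ (by positivity)]
  have h3 : y₀ / 2 * y₀ ≤
      ‖(x : ℂ) - (l + y * Complex.I)‖ * ‖(x : ℂ) - (l + y₀ * Complex.I)‖ :=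
    mul_le_mul (hy.trans h1) h2 hy₀.le (norm_nonneg _)
  calc |y - y₀| = 2 / y₀ ^ 2 * |y - y₀| * (y₀ / 2 * y₀) := by field_simp
    _ ≤ _ := by gcongr

/-- Mean value inequality for the arctangent minus its linear part at `y₀`; the derivative of this
difference is bounded by the Lipschitz estimate for `(x - z)⁻¹`, uniformly in `x`. -/
theorem norm_arctanDiv_sub_le {l y y₀ : ℝ} (hy₀ : 0 < y₀) (hy : y₀ / 2 ≤ y) (x : ℝ) :
    ‖arctanDiv l y x - arctanDiv l y₀ x -
      ((y - y₀ : ℝ) : ℂ) * arctanDeriv (l + y₀ * Complex.I) x‖ ≤ 2 / y₀ ^ 2 * (y - y₀) ^ 2 := by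
  set d := -(((x : ℂ) - (l + y₀ * Complex.I))⁻¹).re
  have hpos : ∀ t ∈ uIcc y₀ y, y₀ / 2 ≤ t := fun t ht ↦
    (le_min (by linarith) hy).trans ht.1
  have h := Convex.norm_image_sub_le_of_norm_hasDerivWithin_le
    (f := fun t ↦ Real.arctan ((x - l) / t) - t * d) (s := uIcc y₀ y) (x := y₀) (y := y)
    (C := 2 / y₀ ^ 2 * |y - y₀|)
    (fun t ht ↦ ((hasDerivAt_arctan_div l x (by linarith [hpos t ht])).sub
      ((hasDerivAt_id t).mul_const d)).hasDerivWithinAt) (fun t ht ↦ ?_) (convex_uIcc _ _)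
    left_mem_uIcc right_mem_uIcc
  · rw [arctanDeriv_eq, arctanDiv, arctanDiv, ← Complex.ofReal_mul, ← Complex.ofReal_sub,
      ← Complex.ofReal_sub, Complex.norm_real]
    have e : (y - y₀) ^ 2 = |y - y₀| * |y - y₀| := by rw [← sq, sq_abs]
    rw [e, ← mul_assoc]
    refine (le_of_eq ?_).trans h
    rw [Real.norm_eq_abs]
    congr 1
    ring
  · have h1 := norm_inv_sub_inv_sub_le (l := l) (x := x) hy₀ (hpos t ht)
    have h2 : |t - y₀| ≤ |y - y₀| := abs_sub_left_of_mem_uIcc ht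
    have h3 := Complex.abs_re_le_norm (((x : ℂ) - (l + t * Complex.I))⁻¹ -
      ((x : ℂ) - (l + y₀ * Complex.I))⁻¹)
    rw [Complex.sub_re] at h3
    rw [one_mul, Real.norm_eq_abs, sub_neg_eq_add, neg_add_eq_sub, abs_sub_comm]
    refine h3.trans (h1.trans ?_)
    gcongr

end Functions

/-! ### Compactness and cut-offs -/

section Cutoff

theorem norm_le_of_unit_ball {T : E →L[ℂ] F} {c : ℝ} (hc : 0 ≤ c)
    (h : ∀ v, ‖v‖ ≤ 1 → ‖T v‖ ≤ c) : ‖T‖ ≤ c := by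
  refine T.opNorm_le_bound hc fun v ↦ ?_
  rcases eq_or_ne v 0 with rfl | hv
  · simp
  · have hv' : 0 < ‖v‖ := norm_pos_iff.mpr hv
    have h1 := h (((‖v‖⁻¹ : ℝ) : ℂ) • v) (by
      rw [norm_smul, Complex.norm_of_nonneg (by positivity), inv_mul_cancel₀ hv'.ne'])
    rwa [map_smul, norm_smul, Complex.norm_of_nonneg (by positivity), inv_mul_le_iff₀ hv',
      mul_comm] at h1

/-- A compact operator turns strong convergence to zero of self-adjoint operators into norm
convergence. -/
theorem eventually_norm_comp_le {C : E →L[ℂ] F} (hC : IsCompactOperator C) {ι : Type*}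
    {l : Filter ι} {X : ι → E →L[ℂ] E} (hsa : ∀ᶠ i in l, IsSelfAdjoint (X i))
    (hX : ∀ᶠ i in l, ‖X i‖ ≤ 1) (h0 : ∀ v, Tendsto (fun i ↦ X i v) l (𝓝 0)) {ε : ℝ}
    (hε : 0 < ε) : ∀ᶠ i in l, ‖C.comp (X i)‖ ≤ 2 * ε := by
  obtain ⟨K, hK, hCK⟩ := IsCompactOperator.image_closedBall_subset_compact
    (f := (C : E →ₗ[ℂ] F)) hC 1
  obtain ⟨t, ht, hKt⟩ := Metric.totallyBounded_iff.mp hK.totallyBounded ε hε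
  have h1 : ∀ᶠ i in l, ∀ y ∈ t, ‖X i (ContinuousLinearMap.adjoint C y)‖ ≤ ε ^ 2 := by
    rw [ht.eventually_all]
    intro y _
    have h := (h0 (ContinuousLinearMap.adjoint C y)).norm
    rw [norm_zero] at h
    exact h.eventually_le_const (by positivity)
  filter_upwards [hsa, hX, h1] with i h2 h3 h4
  refine norm_le_of_unit_ball (by positivity) fun v hv ↦ ?_
  -- Let `y` be a net point within `ε` of `u`. In `‖u‖² = ⟪u - y, u⟫ + ⟪y, u⟫` the last term is `⟪X
  -- C* y, v⟫`, which is small at the finitely many net points. Self-adjointness of `X` enters here.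
  set u := C.comp (X i) v with hu
  have huK : u ∈ K := hCK ⟨X i v, by
    rw [mem_closedBall_zero_iff]
    exact ((X i).le_of_opNorm_le h3 v).trans (by rwa [one_mul]), rfl⟩
  obtain ⟨y, hy, huy⟩ := mem_iUnion₂.mp (hKt huK)
  rw [Metric.mem_ball, dist_eq_norm] at huy
  have h5 : ‖u‖ ^ 2 ≤ ε * ‖u‖ + ε ^ 2 := by
    have e1 : ⟪y, u⟫_ℂ = ⟪X i (ContinuousLinearMap.adjoint C y), v⟫_ℂ := by
      have h := ContinuousLinearMap.adjoint_inner_left (X i) v (ContinuousLinearMap.adjoint C y)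
      rw [← ContinuousLinearMap.star_eq_adjoint (X i), h2.star_eq] at h
      rw [h, ContinuousLinearMap.adjoint_inner_left]
      rfl
    have e2 : (‖u‖ : ℂ) ^ 2 = ⟪u - y, u⟫_ℂ + ⟪y, u⟫_ℂ := by
      rw [← inner_add_left, sub_add_cancel, inner_self_eq_norm_sq_to_K]
      rfl
    calc ‖u‖ ^ 2 = ‖(‖u‖ : ℂ) ^ 2‖ := by rw [norm_pow, Complex.norm_real, norm_norm]
      _ ≤ ‖⟪u - y, u⟫_ℂ‖ + ‖⟪y, u⟫_ℂ‖ := by rw [e2]; exact norm_add_le _ _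
      _ ≤ ‖u - y‖ * ‖u‖ + ‖X i (ContinuousLinearMap.adjoint C y)‖ * ‖v‖ := by
        rw [e1]; exact add_le_add (norm_inner_le_norm _ _) (norm_inner_le_norm _ _)
      _ ≤ ε * ‖u‖ + ε ^ 2 * 1 := by
        have := h4 y hy
        gcongr
      _ = _ := by rw [mul_one]
  nlinarith [norm_nonneg u]

variable {A : E →ₗ.[ℂ] E}

theorem fn_cutoff_add (hA : IsSelfAdjoint A) {R : ℝ} (hR : 0 < R) :
    fn (fun x ↦ (cutoff R x : ℂ)) A + fn (fun x ↦ ((1 - cutoff R x : ℝ) : ℂ)) A = 1 := by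
  simp only [Complex.ofReal_sub, Complex.ofReal_one]
  rw [fn_sub hA (.const 1) (hasLimits_cutoff hR), fn_const hA, one_smul, add_sub_cancel]

theorem hasLimits_one_sub_cutoff {R : ℝ} (hR : 0 < R) :
    HasLimits fun x ↦ ((1 - cutoff R x : ℝ) : ℂ) := by
  simp only [Complex.ofReal_sub, Complex.ofReal_one]
  exact (HasLimits.const 1).sub (hasLimits_cutoff hR)

/-- `1 - R / (|x| + R)` is at most `1` and at most `|x| / R`, so the corresponding operators tend
strongly to zero; compactness of `C` upgrades this to norm convergence. -/
theorem exists_cutoff (hA : IsSelfAdjoint A) {C : E →L[ℂ] F} (hC : IsCompactOperator C) {ε : ℝ}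
    (hε : 0 < ε) :
    ∃ R : ℝ, 1 ≤ R ∧ ‖C.comp (fn (fun x ↦ ((1 - cutoff R x : ℝ) : ℂ)) A)‖ ≤ ε := by
  have hpos : ∀ᶠ R : ℝ in atTop, 0 < R := eventually_gt_atTop 0
  have h := eventually_norm_comp_le hC (l := atTop)
    (X := fun R : ℝ ↦ fn (fun x ↦ ((1 - cutoff R x : ℝ) : ℂ)) A) ?_ ?_ ?_ (half_pos hε)
  · obtain ⟨R, h1, h2⟩ := (h.and (eventually_ge_atTop 1)).exists
    exact ⟨R, h2, by linarith⟩
  · filter_upwards [hpos] with R hR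
    rw [isSelfAdjoint_iff, star_fn hA (hasLimits_one_sub_cutoff hR)]
    simp only [Complex.conj_ofReal]
  · filter_upwards [hpos] with R hR
    refine norm_fn_le hA (hasLimits_one_sub_cutoff hR) fun x ↦ ?_
    rw [Complex.norm_real]
    exact abs_one_sub_cutoff_le_one hR x
  · refine tendsto_fn_apply hA (c := 1) (b := fun R ↦ R⁻¹) ?_ ?_ tendsto_inv_atTop_zero ?_
    · filter_upwards [hpos] with R hR using hasLimits_one_sub_cutoff hR
    · filter_upwards [hpos] with R hR x
      rw [Complex.norm_real]
      exact abs_one_sub_cutoff_le_one hR x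
    · filter_upwards [hpos] with R hR x
      rw [Complex.norm_real]
      exact abs_one_sub_cutoff_le hR x

/-! ### The factor `C (|A| + I)^{1/2} (A - z)⁻¹` and its majorant. -/

/-- The operator `(|A| + I)^{1/2} (A - z I)⁻¹`. -/
def sqrtAbsRes (A : E →ₗ.[ℂ] E) (z : ℂ) : E →L[ℂ] E :=
  fn (fun x ↦ ((√(|x| + 1) : ℝ) : ℂ) * ((x : ℂ) - z)⁻¹) A

theorem invSqrtAbsAddOne_mul_sqrtAbsRes (hA : IsSelfAdjoint A) {z : ℂ} (hz : z.im ≠ 0) :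
    invSqrtAbsAddOne A * sqrtAbsRes A z = res A z := by
  rw [invSqrtAbsAddOne, sqrtAbsRes, ← fn_mul hA hasLimits_inv_sqrt_abs_add_one
    (hasLimits_sqrt_mul_inv hz), ← fn_inv_sub hA hz]
  congr 1
  ext x
  have h' : ((√(|x| + 1) : ℝ) : ℂ) ≠ 0 :=
    Complex.ofReal_ne_zero.mpr (Real.sqrt_pos.mpr (by positivity)).ne'
  push_cast
  rw [← mul_assoc, one_div, inv_mul_cancel₀ h', one_mul]

theorem product_res {G : E →ₗ.[ℂ] F} {C : E →L[ℂ] F} (hA : IsSelfAdjoint A)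
    (hC : IsProduct G (invSqrtAbsAddOne A) C) {z : ℂ} (hz : z.im ≠ 0) :
    product G (res A z) = C.comp (sqrtAbsRes A z) := by
  refine IsProduct.product_eq fun x ↦ ?_
  rw [← invSqrtAbsAddOne_mul_sqrtAbsRes hA hz]
  exact hC _

/-- The coefficient in `majorant`. -/
def majorantCoeff (c ε R x : ℝ) : ℝ := 10 * (c ^ 2 * cutoff R x ^ 2 + ε ^ 2)

theorem hasLimits_majorantCoeff (c ε : ℝ) {R : ℝ} (hR : 0 < R) :
    HasLimits fun x ↦ (majorantCoeff c ε R x : ℂ) :=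
  (hasLimits_cutoff hR).comp
    (φ := fun w ↦ ((10 * (c ^ 2 * w.re ^ 2 + ε ^ 2) : ℝ) : ℂ)) (by fun_prop)

theorem majorantCoeff_nonneg (c ε R x : ℝ) : 0 ≤ majorantCoeff c ε R x := by
  unfold majorantCoeff
  positivity

theorem majorantCoeff_le (c ε : ℝ) {R : ℝ} (hR : 0 < R) (x : ℝ) :
    majorantCoeff c ε R x ≤ 10 * (c ^ 2 + ε ^ 2) := by
  have h := pow_le_one₀ (n := 2) (cutoff_nonneg hR x) (cutoff_le_one hR x)
  unfold majorantCoeff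
  nlinarith [mul_le_mul_of_nonneg_left h (sq_nonneg c)]

/-- A nonincreasing family of bounded functions whose derivative in `y` controls
`‖C (|A| + I)^{1/2} (A - z I)⁻¹ v‖²` on the line `z = l + i y`. -/
def majorant (c ε R y x : ℝ) : ℝ := majorantCoeff c ε R x * weight y x

theorem hasLimits_majorant (c ε : ℝ) {R y : ℝ} (hR : 0 < R) (hy : 0 < y) :
    HasLimits fun x ↦ (majorant c ε R y x : ℂ) := by
  simp only [majorant, Complex.ofReal_mul]
  exact (hasLimits_majorantCoeff c ε hR).mul (hasLimits_weight hy)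

theorem majorant_nonneg (c ε R : ℝ) {y : ℝ} (hy : 0 < y) (x : ℝ) : 0 ≤ majorant c ε R y x :=
  mul_nonneg (majorantCoeff_nonneg c ε R x) (weight_nonneg hy x)

theorem majorant_le (c ε : ℝ) {R y : ℝ} (hR : 1 ≤ R) (hy : 1 ≤ y) (x : ℝ) :
    majorant c ε R y x ≤ 10 * (c ^ 2 * (R / y) + ε ^ 2) := by
  have hR0 : 0 < R := by linarith
  have hy0 : 0 < y := by linarith
  have h1 : cutoff R x ^ 2 * weight y x ≤ R / y := by
    rw [sq, mul_assoc]
    have h := cutoff_mul_weight_le hR hy0 x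
    have h' := mul_nonneg (cutoff_nonneg hR0 x) (weight_nonneg hy0 x)
    nlinarith [cutoff_le_one hR0 x, cutoff_nonneg hR0 x]
  have h2 := weight_le_one hy x
  calc majorant c ε R y x =
      10 * (c ^ 2 * (cutoff R x ^ 2 * weight y x) + ε ^ 2 * weight y x) := by
        unfold majorant majorantCoeff; ring
    _ ≤ 10 * (c ^ 2 * (R / y) + ε ^ 2 * 1) := by gcongr
    _ = _ := by rw [mul_one]

theorem hasDerivAt_fn_majorant (hA : IsSelfAdjoint A) (c ε : ℝ) {R y : ℝ} (hR : 0 < R)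
    (hy : 1 ≤ y) :
    HasDerivAt (fun y ↦ fn (fun x ↦ (majorant c ε R y x : ℂ)) A)
      (-fn (fun x ↦ ((majorantCoeff c ε R x * weightDeriv y x : ℝ) : ℂ)) A) y := by
  have hy0 : 0 < y := by linarith
  have hl : HasLimits fun x ↦ ((majorantCoeff c ε R x * weightDeriv y x : ℝ) : ℂ) := by
    simp only [Complex.ofReal_mul]
    exact (hasLimits_majorantCoeff c ε hR).mul (hasLimits_weightDeriv hy0)
  rw [← neg_one_smul ℂ, ← fn_const_mul hA hl]
  have hev : ∀ᶠ t in 𝓝 y, 1 / 2 ≤ t := eventually_ge_nhds (by linarith)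
  refine hasDerivAt_fn hA (c := 10 * (c ^ 2 + ε ^ 2) * 2) ?_ (hl.const_mul _) ?_
  · filter_upwards [hev] with t ht using hasLimits_majorant c ε hR (by linarith)
  · filter_upwards [hev] with t ht x
    have h1 := abs_weight_sub_le ht hy x
    have e : majorant c ε R t x - majorant c ε R y x -
        (t - y) * (-1 * (majorantCoeff c ε R x * weightDeriv y x)) =
        majorantCoeff c ε R x * (weight t x - weight y x - (t - y) * -weightDeriv y x) := by
      unfold majorant; ring
    have e' := congrArg (fun s : ℝ ↦ (s : ℂ)) e
    push_cast at e'
    push_cast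
    rw [e']
    have e2 := congrArg norm (Complex.ofReal_mul (majorantCoeff c ε R x)
      (weight t x - weight y x - (t - y) * -weightDeriv y x))
    push_cast at e2
    rw [← e2]
    have e3 := Complex.norm_real (majorantCoeff c ε R x *
      (weight t x - weight y x - (t - y) * -weightDeriv y x))
    push_cast at e3
    rw [e3, norm_mul, Real.norm_of_nonneg (majorantCoeff_nonneg c ε R x), Real.norm_eq_abs,
      mul_assoc _ 2]
    exact mul_le_mul (majorantCoeff_le c ε hR x) h1 (abs_nonneg _) (by positivity)

theorem norm_comp_le_cutoff (hA : IsSelfAdjoint A) (C : E →L[ℂ] F) {R ε : ℝ} (hR : 0 < R)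
    (hC : ‖C.comp (fn (fun x ↦ ((1 - cutoff R x : ℝ) : ℂ)) A)‖ ≤ ε) (v : E) :
    ‖C v‖ ≤ ‖C‖ * ‖fn (fun x ↦ (cutoff R x : ℂ)) A v‖ + ε * ‖v‖ := by
  have h := congrArg (fun T : E →L[ℂ] E ↦ C (T v)) (fn_cutoff_add hA hR)
  simp only [add_apply, map_add] at h
  rw [show C v = C ((1 : E →L[ℂ] E) v) from rfl, ← h]
  exact (norm_add_le _ _).trans (add_le_add (C.le_opNorm _) (ContinuousLinearMap.le_of_opNorm_le
    (C.comp (fn (fun x ↦ ((1 - cutoff R x : ℝ) : ℂ)) A)) hC v))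

/-- Split `C` with the cut-off and use `(a + b)² ≤ 2 a² + 2 b²`; this `2` times the `5` of the
pointwise bound is the `10` in `majorantCoeff`. -/
theorem norm_comp_sqrtAbsRes_sq_le (hA : IsSelfAdjoint A) (C : E →L[ℂ] F) {R ε y : ℝ}
    (hR : 0 < R) (hC : ‖C.comp (fn (fun x ↦ ((1 - cutoff R x : ℝ) : ℂ)) A)‖ ≤ ε) {z : ℂ}
    (hy : |z.im| = y) (hy0 : 0 < y) (hz : 2 * |z.re| ≤ y) (v : E) :
    ‖C.comp (sqrtAbsRes A z) v‖ ^ 2 ≤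
      (⟪v, fn (fun x ↦ ((majorantCoeff ‖C‖ ε R x * weightDeriv y x : ℝ) : ℂ)) A v⟫_ℂ).re := by
  have hz' : z.im ≠ 0 := abs_pos.mp (hy ▸ hy0)
  have hp := hasLimits_cutoff hR
  have hs := hasLimits_sqrt_mul_inv hz'
  have h1 := norm_comp_le_cutoff hA C hR hC (sqrtAbsRes A z v)
  have h2 := norm_fn_apply_sq hA (hp.mul hs) v
  have h3 := norm_fn_apply_sq hA hs v
  rw [fn_mul hA hp hs] at h2
  have hq : ∀ {f : ℝ → ℂ}, HasLimits f → HasLimits fun x ↦ ((‖f x‖ ^ 2 : ℝ) : ℂ) := fun hf ↦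
    hf.comp (φ := fun w ↦ ((‖w‖ ^ 2 : ℝ) : ℂ)) (by fun_prop)
  have hκ : HasLimits fun x ↦ ((majorantCoeff ‖C‖ ε R x * weightDeriv y x : ℝ) : ℂ) := by
    simp only [Complex.ofReal_mul]
    exact (hasLimits_majorantCoeff ‖C‖ ε hR).mul (hasLimits_weightDeriv hy0)
  have hk1 := (hq (hp.mul hs)).const_mul ((2 * ‖C‖ ^ 2 : ℝ) : ℂ)
  have hk2 := (hq hs).const_mul ((2 * ε ^ 2 : ℝ) : ℂ)
  have h4 := fn_add hA hk1 hk2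
  rw [fn_const_mul hA (hq (hp.mul hs)), fn_const_mul hA (hq hs)] at h4
  have hsum := hk1.add hk2
  simp only [← Complex.ofReal_mul, ← Complex.ofReal_add] at h4 hsum
  have h5 := re_inner_fn_mono hA hsum hκ (fun x ↦ ?_) v
  · rw [h4, add_apply, smul_apply, smul_apply, inner_add_right, inner_smul_right,
      inner_smul_right, Complex.add_re, Complex.re_ofReal_mul, Complex.re_ofReal_mul, ← h2,
      ← h3] at h5
    refine le_trans ?_ h5
    have h6 := pow_le_pow_left₀ (norm_nonneg _) h1 2
    have h7 := sq_nonneg (‖C‖ * ‖fn (fun x ↦ (cutoff R x : ℂ)) A (sqrtAbsRes A z v)‖ -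
      ε * ‖sqrtAbsRes A z v‖)
    change ‖C (sqrtAbsRes A z v)‖ ^ 2 ≤
      2 * ‖C‖ ^ 2 * ‖fn (fun x ↦ (cutoff R x : ℂ)) A (sqrtAbsRes A z v)‖ ^ 2 +
        2 * ε ^ 2 * ‖sqrtAbsRes A z v‖ ^ 2
    nlinarith
  · have h6 := norm_sqrt_mul_inv_sq_le hy hy0 hz x
    rw [norm_mul (cutoff R x : ℂ), mul_pow, Complex.norm_real, Real.norm_eq_abs, sq_abs]
    calc _ = (2 * ‖C‖ ^ 2 * cutoff R x ^ 2 + 2 * ε ^ 2) *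
          ‖((√(|x| + 1) : ℝ) : ℂ) * ((x : ℂ) - z)⁻¹‖ ^ 2 := by ring
      _ ≤ (2 * ‖C‖ ^ 2 * cutoff R x ^ 2 + 2 * ε ^ 2) * (5 * weightDeriv y x) := by gcongr
      _ = _ := by unfold majorantCoeff; ring

theorem exists_norm_sandwich_le (hA : IsSelfAdjoint A) {C : E →L[ℂ] F}
    (hC : IsCompactOperator C) {δ : ℝ} (hδ : 0 < δ) :
    ∃ Y : ℝ, 1 ≤ Y ∧ ∀ z : ℂ, Y ≤ |z.im| → 2 * |z.re| ≤ |z.im| →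
      ‖C.comp ((absAddOneDivSub A z).comp (ContinuousLinearMap.adjoint C))‖ ≤ δ := by
  obtain ⟨R, hR, hCR⟩ := exists_cutoff hA hC
    (show 0 < δ / (6 * (‖C‖ + 1)) by positivity)
  set ε := δ / (6 * (‖C‖ + 1)) with hε
  -- The cut-off part contributes at most `3 ‖C‖² R / |Im z|` and the remainder at most `3 ε ‖C‖`.
  -- The threshold and `ε` make each at most `δ / 2`.
  refine ⟨max 1 (6 * R * (‖C‖ + 1) ^ 2 / δ), le_max_left _ _, fun z h1 h2 ↦ ?_⟩
  have hR0 : 0 < R := by linarith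
  have hy1 : 1 ≤ |z.im| := (le_max_left _ _).trans h1
  have hyR := (le_max_right _ _).trans h1
  have hy0 : 0 < |z.im| := by linarith
  have hz : z.im ≠ 0 := abs_pos.mp hy0
  have hX := norm_abs_add_one_div_sub_le rfl hy0 h2
  have h3 : ‖absAddOneDivSub A z‖ ≤ 3 := norm_fn_le hA (hasLimits_abs_add_one_div_sub hz)
    fun x ↦ (hX x).trans (by linarith [weight_le_one hy1 x])
  have h4 : ‖fn (fun x ↦ (cutoff R x : ℂ)) A * absAddOneDivSub A z‖ ≤ 3 * (R / |z.im|) := by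
    rw [absAddOneDivSub, ← fn_mul hA (hasLimits_cutoff hR0) (hasLimits_abs_add_one_div_sub hz)]
    refine norm_fn_le hA ((hasLimits_cutoff hR0).mul (hasLimits_abs_add_one_div_sub hz))
      fun x ↦ ?_
    rw [norm_mul, Complex.norm_of_nonneg (cutoff_nonneg hR0 x)]
    have := mul_le_mul_of_nonneg_left (hX x) (cutoff_nonneg hR0 x)
    linarith [cutoff_mul_weight_le hR hy0 x]
  have h5 : ‖C.comp (absAddOneDivSub A z)‖ ≤ ‖C‖ * (3 * (R / |z.im|)) + ε * 3 := by
    refine ContinuousLinearMap.opNorm_le_bound _ (by positivity) fun v ↦ ?_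
    refine (norm_comp_le_cutoff hA C hR0 hCR (absAddOneDivSub A z v)).trans ?_
    have h6 := (fn (fun x ↦ (cutoff R x : ℂ)) A * absAddOneDivSub A z).le_of_opNorm_le h4 v
    have h7 := (absAddOneDivSub A z).le_of_opNorm_le h3 v
    rw [add_mul, mul_assoc, mul_assoc ε]
    exact add_le_add (mul_le_mul_of_nonneg_left h6 (norm_nonneg _))
      (mul_le_mul_of_nonneg_left h7 (by positivity))
  have h6 : R / |z.im| ≤ δ / (6 * (‖C‖ + 1) ^ 2) := by
    rw [div_le_iff₀ hδ] at hyR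
    rw [div_le_div_iff₀ hy0 (by positivity)]
    linarith
  rw [← ContinuousLinearMap.comp_assoc]
  refine (ContinuousLinearMap.opNorm_comp_le _ _).trans ?_
  rw [LinearIsometryEquiv.norm_map]
  have hc := norm_nonneg C
  calc ‖C.comp (absAddOneDivSub A z)‖ * ‖C‖
      ≤ (‖C‖ * (3 * (δ / (6 * (‖C‖ + 1) ^ 2))) + ε * 3) * ‖C‖ := by gcongr; exact h5.trans (by gcongr)
    _ = δ / 2 * (‖C‖ ^ 2 / (‖C‖ + 1) ^ 2) + δ / 2 * (‖C‖ / (‖C‖ + 1)) := by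
      rw [hε]; field_simp; ring
    _ ≤ δ / 2 * 1 + δ / 2 * 1 := by
      gcongr
      · exact div_le_one_of_le₀ (by gcongr; linarith) (by positivity)
      · exact div_le_one_of_le₀ (by linarith) (by positivity)
    _ = δ := by ring

/-- The inverse `S` satisfies `S = 1 - T S`, so `‖S‖ ≤ 1 + ‖S‖ / 2`. -/
theorem norm_inverse_one_add_le {T : F →L[ℂ] F} (hT : ‖T‖ ≤ 1 / 2) :
    ‖Ring.inverse (1 + T)‖ ≤ 2 := by
  have hu : IsUnit (1 + T) := by
    rw [← sub_neg_eq_add]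
    exact isUnit_one_sub_of_norm_lt_one (by rw [norm_neg]; linarith)
  have h := Ring.mul_inverse_cancel _ hu
  set S := Ring.inverse (1 + T)
  have h1 : S = 1 - T * S := by rw [eq_sub_iff_add_eq, ← h]; noncomm_ring
  have h2 : ‖S‖ ≤ 1 + 1 / 2 * ‖S‖ := by
    calc ‖S‖ = ‖1 - T * S‖ := by rw [← h1]
      _ ≤ ‖(1 : F →L[ℂ] F)‖ + ‖T * S‖ := norm_sub_le _ _
      _ ≤ 1 + 1 / 2 * ‖S‖ := add_le_add ContinuousLinearMap.norm_id_le
        ((norm_mul_le _ _).trans (by gcongr))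
  linarith

end Cutoff

/-! ### The difference of the arguments -/

section Difference

variable {H₀ H : E →ₗ.[ℂ] E}

theorem argSub_eq {A : E →ₗ.[ℂ] E} (hA : IsSelfAdjoint A) {z : ℂ} (hz : 0 < z.im) :
    argSub A z = fn (arctanDiv z.re z.im) A - ((Real.pi / 2 : ℝ) : ℂ) • (1 : E →L[ℂ] E) := by
  rw [argSub, ← fn_const hA, ← fn_sub hA (hasLimits_arctanDiv _ hz) (.const _)]
  simp only [arg_ofReal_sub hz]

/-- The difference of the functions `arctan ((x - l) / y)` of `H` and of `H₀`. -/
def arctanDiff (H₀ H : E →ₗ.[ℂ] E) (l y : ℝ) : E →L[ℂ] E :=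
  fn (arctanDiv l y) H - fn (arctanDiv l y) H₀

theorem argSub_sub_argSub (hH₀ : IsSelfAdjoint H₀) (hH : IsSelfAdjoint H) {z : ℂ}
    (hz : 0 < z.im) : argSub H z - argSub H₀ z = arctanDiff H₀ H z.re z.im := by
  rw [argSub_eq hH₀ hz, argSub_eq hH hz, sub_sub_sub_cancel_right, arctanDiff]

theorem hasDerivAt_fn_arctanDiv {A : E →ₗ.[ℂ] E} (hA : IsSelfAdjoint A) (l : ℝ) {y : ℝ}
    (hy : 0 < y) :
    HasDerivAt (fun y ↦ fn (arctanDiv l y) A)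
      (-(1 / 2 : ℂ) • (res A (l + y * Complex.I) + res A (conj (l + y * Complex.I)))) y := by
  have hz : (l + y * Complex.I : ℂ).im ≠ 0 := by simpa using hy.ne'
  have hz' : (conj (l + y * Complex.I : ℂ)).im ≠ 0 := by simpa using hy.ne'
  rw [← fn_inv_sub hA hz, ← fn_inv_sub hA hz', ← fn_add hA (hasLimits_inv_sub hz)
    (hasLimits_inv_sub hz'), ← fn_const_mul hA ((hasLimits_inv_sub hz).add (hasLimits_inv_sub hz'))]
  have hev : ∀ᶠ t in 𝓝 y, y / 2 ≤ t := eventually_ge_nhds (by linarith)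
  refine hasDerivAt_fn hA (f' := arctanDeriv (l + y * Complex.I)) (c := 2 / y ^ 2) ?_
    (hasLimits_arctanDeriv hz) ?_
  · filter_upwards [hev] with t ht using hasLimits_arctanDiv l (by linarith)
  · filter_upwards [hev] with t ht x using norm_arctanDiv_sub_le hy ht x

theorem hasDerivAt_arctanDiff (hH₀ : IsSelfAdjoint H₀) (hH : IsSelfAdjoint H) (l : ℝ) {y : ℝ}
    (hy : 0 < y) :
    HasDerivAt (arctanDiff H₀ H l)
      (-(1 / 2 : ℂ) • ((res H (l + y * Complex.I) - res H₀ (l + y * Complex.I)) +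
        (res H (conj (l + y * Complex.I)) - res H₀ (conj (l + y * Complex.I))))) y := by
  refine ((hasDerivAt_fn_arctanDiv hH l hy).sub (hasDerivAt_fn_arctanDiv hH₀ l hy)).congr_deriv ?_
  module

theorem tendsto_fn_arctanDiv {A : E →ₗ.[ℂ] E} (hA : IsSelfAdjoint A) (l : ℝ) (v : E) :
    Tendsto (fun y ↦ fn (arctanDiv l y) A v) atTop (𝓝 0) := by
  have hpos : ∀ᶠ y : ℝ in atTop, 0 < y := eventually_gt_atTop 0
  refine tendsto_fn_apply hA (c := 2) (b := fun y ↦ (1 + |l|) / y) ?_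
    (.of_forall fun y x ↦ norm_arctanDiv_le l y x) (tendsto_const_nhds.div_atTop tendsto_id) ?_ v
  · filter_upwards [hpos] with y hy using hasLimits_arctanDiv l hy
  · filter_upwards [hpos] with y hy x using norm_arctanDiv_le_mul l hy x

theorem tendsto_arctanDiff (hH₀ : IsSelfAdjoint H₀) (hH : IsSelfAdjoint H) (l : ℝ) (v : E) :
    Tendsto (fun y ↦ arctanDiff H₀ H l y v) atTop (𝓝 0) := by
  have h := (tendsto_fn_arctanDiv hH l v).sub (tendsto_fn_arctanDiv hH₀ l v)
  rwa [sub_zero] at h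

theorem norm_le_of_re_inner_le {T : E →L[ℂ] E} {b : ℝ} (hb : 0 ≤ b)
    (h : ∀ g f, (⟪g, T f⟫_ℂ).re ≤ b * (‖g‖ ^ 2 + ‖f‖ ^ 2)) : ‖T‖ ≤ 2 * b := by
  refine T.opNorm_le_bound (by positivity) fun f ↦ ?_
  rcases eq_or_ne (T f) 0 with h0 | h0
  · rw [h0, norm_zero]
    positivity
  have hT : 0 < ‖T f‖ := norm_pos_iff.mpr h0
  have hf : 0 < ‖f‖ := norm_pos_iff.mpr fun e ↦ h0 (by rw [e, map_zero])
  -- The test vector is parallel to `T f` and has the norm of `f`, which balances the two squares.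
  have h1 := h (((‖f‖ / ‖T f‖ : ℝ) : ℂ) • T f) f
  rw [inner_smul_left, Complex.conj_ofReal, Complex.re_ofReal_mul, norm_smul,
    Complex.norm_of_nonneg (by positivity), div_mul_cancel₀ _ hT.ne'] at h1
  have h2 : (⟪T f, T f⟫_ℂ).re = ‖T f‖ ^ 2 := inner_self_eq_norm_sq (𝕜 := ℂ) (T f)
  rw [h2, show ‖f‖ / ‖T f‖ * ‖T f‖ ^ 2 = ‖f‖ * ‖T f‖ by field_simp] at h1
  nlinarith

/-- If the derivative of `h` is dominated by minus the derivative of a nonnegative function `N`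
and `h` tends to zero at infinity, then `h ≤ N`. -/
theorem le_of_deriv_le_neg_deriv {h h' N N' : ℝ → ℝ} {Y : ℝ}
    (hh : ∀ y, Y ≤ y → HasDerivAt h (h' y) y) (hN : ∀ y, Y ≤ y → HasDerivAt N (N' y) y)
    (hle : ∀ y, Y ≤ y → N' y ≤ h' y) (hN0 : ∀ y, Y ≤ y → 0 ≤ N y)
    (hlim : Tendsto h atTop (𝓝 0)) {y : ℝ} (hy : Y ≤ y) : h y ≤ N y := by
  have hd : ∀ t, Y ≤ t → HasDerivAt (fun t ↦ h t - N t) (h' t - N' t) t :=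
    fun t ht ↦ (hh t ht).sub (hN t ht)
  have hmono : MonotoneOn (fun t ↦ h t - N t) (Ici Y) := by
    refine monotoneOn_of_deriv_nonneg (convex_Ici Y)
      (fun t ht ↦ (hd t ht).continuousAt.continuousWithinAt) (fun t ht ↦ ?_) fun t ht ↦ ?_
    · exact (hd t (interior_subset ht)).differentiableAt.differentiableWithinAt
    · rw [(hd t (interior_subset ht)).deriv]
      linarith [hle t (interior_subset ht)]
  have h1 : h y - N y ≤ 0 := by
    refine ge_of_tendsto hlim ?_
    filter_upwards [eventually_ge_atTop y] with t ht
    have h2 := hmono hy (hy.trans ht) ht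
    have h3 := hN0 t (hy.trans ht)
    simp only at h2
    linarith
  linarith

/-! ### Consequences of the resolvent equation. -/

variable {G : E →ₗ.[ℂ] F} {J : F →L[ℂ] F} {C : E →L[ℂ] F}

theorem res_sub_res_eq (hH₀ : IsSelfAdjoint H₀) (hH : IsPerturbation H₀ G J H)
    (hC : IsProduct G (invSqrtAbsAddOne H₀) C) {z : ℂ} (hz : z.im ≠ 0) :
    res H z - res H₀ z = -((ContinuousLinearMap.adjoint (C.comp (sqrtAbsRes H₀ (conj z)))).comp
      ((Ring.inverse (1 + J * C.comp ((absAddOneDivSub H₀ z).comp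
        (ContinuousLinearMap.adjoint C)))).comp (J.comp (C.comp (sqrtAbsRes H₀ z))))) := by
  rw [hH.resolvent_eq z hz, product_res hH₀ hC hz, product_res hH₀ hC (by simpa using hz),
    sandwich, hC.product_eq]

theorem isCompactOperator_res_sub_res (hH₀ : IsSelfAdjoint H₀) (hH : IsPerturbation H₀ G J H)
    (hC : IsProduct G (invSqrtAbsAddOne H₀) C) (hCc : IsCompactOperator C) {z : ℂ}
    (hz : z.im ≠ 0) : IsCompactOperator (res H z - res H₀ z : E →L[ℂ] E) := by
  rw [res_sub_res_eq hH₀ hH hC hz]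
  exact IsCompactOperator.neg ((((hCc.comp_clm (sqrtAbsRes H₀ z)).clm_comp J).clm_comp
    (Ring.inverse (1 + J * C.comp ((absAddOneDivSub H₀ z).comp
      (ContinuousLinearMap.adjoint C))))).clm_comp
    (ContinuousLinearMap.adjoint (C.comp (sqrtAbsRes H₀ (conj z)))))

/-- The bound `2` on the Neumann inverse is absorbed by `2 a b ≤ a² + b²`. Separating `g` from `f`
leaves quadratic forms, which can be integrated in `y`. -/
theorem abs_re_inner_res_sub_res_le (hH₀ : IsSelfAdjoint H₀) (hH : IsPerturbation H₀ G J H)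
    (hC : IsProduct G (invSqrtAbsAddOne H₀) C) {z : ℂ} (hz : z.im ≠ 0)
    (hT : ‖J * C.comp ((absAddOneDivSub H₀ z).comp (ContinuousLinearMap.adjoint C))‖ ≤ 1 / 2)
    (g f : E) :
    |(⟪g, (res H z - res H₀ z) f⟫_ℂ).re| ≤
      ‖J‖ * (‖C.comp (sqrtAbsRes H₀ (conj z)) g‖ ^ 2 + ‖C.comp (sqrtAbsRes H₀ z) f‖ ^ 2) := by
  have hI := norm_inverse_one_add_le hT
  rw [res_sub_res_eq hH₀ hH hC hz]
  set M := Ring.inverse (1 + J * C.comp ((absAddOneDivSub H₀ z).comp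
    (ContinuousLinearMap.adjoint C)))
  set P := C.comp (sqrtAbsRes H₀ (conj z))
  set Q := C.comp (sqrtAbsRes H₀ z)
  refine (Complex.abs_re_le_norm _).trans ?_
  have e : ⟪g, (-((ContinuousLinearMap.adjoint P).comp (M.comp (J.comp Q)))) f⟫_ℂ =
      -⟪P g, M (J (Q f))⟫_ℂ := by
    rw [neg_apply, inner_neg_right, neg_inj]
    exact ContinuousLinearMap.adjoint_inner_right P g _
  rw [e, norm_neg]
  have h1 : ‖M (J (Q f))‖ ≤ 2 * (‖J‖ * ‖Q f‖) :=
    (M.le_of_opNorm_le hI _).trans (by gcongr; exact J.le_opNorm _)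
  calc ‖⟪P g, M (J (Q f))⟫_ℂ‖ ≤ ‖P g‖ * ‖M (J (Q f))‖ := norm_inner_le_norm _ _
    _ ≤ ‖P g‖ * (2 * (‖J‖ * ‖Q f‖)) := by gcongr
    _ = ‖J‖ * (2 * ‖P g‖ * ‖Q f‖) := by ring
    _ ≤ _ := by gcongr; exact two_mul_le_add_sq _ _

theorem re_inner_arctanDiff_le (hH₀ : IsSelfAdjoint H₀) (hH : IsPerturbation H₀ G J H)
    (hC : IsProduct G (invSqrtAbsAddOne H₀) C) {l R ε Y : ℝ} (hR : 1 ≤ R)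
    (hCR : ‖C.comp (fn (fun x ↦ ((1 - cutoff R x : ℝ) : ℂ)) H₀)‖ ≤ ε) (hY : 1 ≤ Y)
    (hl : 2 * |l| ≤ Y)
    (hT : ∀ z : ℂ, Y ≤ |z.im| → 2 * |z.re| ≤ |z.im| →
      ‖J * C.comp ((absAddOneDivSub H₀ z).comp (ContinuousLinearMap.adjoint C))‖ ≤ 1 / 2)
    {y : ℝ} (hy : Y ≤ y) (g f : E) :
    (⟪g, arctanDiff H₀ H l y f⟫_ℂ).re ≤
      ‖J‖ * (10 * (‖C‖ ^ 2 * (R / y) + ε ^ 2)) * (‖g‖ ^ 2 + ‖f‖ ^ 2) := by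
  have hR0 : 0 < R := by linarith
  set K : ℝ → E → ℝ := fun y v ↦
    (⟪v, fn (fun x ↦ (majorant ‖C‖ ε R y x : ℂ)) H₀ v⟫_ℂ).re with hK
  set k : ℝ → E → ℝ := fun y v ↦
    (⟪v, fn (fun x ↦ ((majorantCoeff ‖C‖ ε R x * weightDeriv y x : ℝ) : ℂ)) H₀ v⟫_ℂ).re with hk
  have happly : ∀ (Φ : ℝ → E →L[ℂ] E) (Φ' : E →L[ℂ] E) (t : ℝ) (u v : E), HasDerivAt Φ Φ' t →
      HasDerivAt (fun t ↦ (⟪u, Φ t v⟫_ℂ).re) (⟪u, Φ' v⟫_ℂ).re t := fun Φ Φ' t u v h ↦ by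
    let L : (E →L[ℂ] E) →L[ℝ] ℝ :=
      Complex.reCLM.comp (((innerSL ℂ u).comp
        (ContinuousLinearMap.apply ℂ E v)).restrictScalars ℝ)
    exact L.hasFDerivAt.comp_hasDerivAt t h
  have hKd : ∀ v t, Y ≤ t → HasDerivAt (fun t ↦ K t v) (-k t v) t := fun v t ht ↦ by
    have h := happly _ _ _ v v (hasDerivAt_fn_majorant hH₀ ‖C‖ ε hR0 (hY.trans ht))
    rwa [neg_apply, inner_neg_right, Complex.neg_re] at h
  have hKnn : ∀ v t, Y ≤ t → 0 ≤ K t v := fun v t ht ↦ by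
    have ht0 : 0 < t := by linarith
    simp only [hK]
    rw [re_inner_fn_eq hH₀ (hasLimits_majorant ‖C‖ ε hR0 ht0) (majorant_nonneg ‖C‖ ε R ht0)]
    positivity
  have hKle : ∀ v, K y v ≤ 10 * (‖C‖ ^ 2 * (R / y) + ε ^ 2) * ‖v‖ ^ 2 := fun v ↦ by
    have h := re_inner_fn_mono hH₀ (hasLimits_majorant ‖C‖ ε hR0 (by linarith))
      (HasLimits.const _) (majorant_le ‖C‖ ε hR (hY.trans hy)) v
    rw [fn_const hH₀, smul_apply, one_apply_eq_self, inner_smul_right, Complex.re_ofReal_mul] at h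
    rwa [show (⟪v, v⟫_ℂ).re = ‖v‖ ^ 2 from inner_self_eq_norm_sq (𝕜 := ℂ) v] at h
  have hmain := le_of_deriv_le_neg_deriv (Y := Y)
    (h := fun t ↦ (⟪g, arctanDiff H₀ H l t f⟫_ℂ).re)
    (N := fun t ↦ ‖J‖ * (K t g + K t f)) (N' := fun t ↦ ‖J‖ * (-k t g + -k t f))
    (fun t ht ↦ happly _ _ _ g f
      (hasDerivAt_arctanDiff hH₀ hH.selfAdjoint l (show 0 < t by linarith)))
    (fun t ht ↦ ((hKd g t ht).add (hKd f t ht)).const_mul _)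
    (fun t ht ↦ ?_)
    (fun t ht ↦ mul_nonneg (norm_nonneg _) (add_nonneg (hKnn g t ht) (hKnn f t ht))) ?_ hy
  · refine hmain.trans ?_
    rw [mul_assoc, mul_add _ (‖g‖ ^ 2)]
    gcongr
    · exact hKle g
    · exact hKle f
  · have ht0 : 0 < t := by linarith
    set z : ℂ := l + t * Complex.I with hz
    have hre : z.re = l := by simp [hz]
    have him : z.im = t := by simp [hz]
    have hre' : (conj z).re = l := by rw [Complex.conj_re, hre]
    have him' : |(conj z).im| = t := by rw [Complex.conj_im, abs_neg, him, abs_of_pos ht0]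
    have hlt : 2 * |l| ≤ t := hl.trans ht
    have him0 : |z.im| = t := by rw [him, abs_of_pos ht0]
    have hz0 : z.im ≠ 0 := by rw [him]; exact ht0.ne'
    have hz0' : (conj z).im ≠ 0 := by simpa using hz0
    have h1 := abs_re_inner_res_sub_res_le hH₀ hH hC hz0
      (hT z (by rwa [him0]) (by rwa [him0, hre])) g f
    have h2 := abs_re_inner_res_sub_res_le hH₀ hH hC hz0'
      (hT (conj z) (by rwa [him']) (by rwa [him', hre'])) g f
    rw [Complex.conj_conj] at h2
    have b1 := norm_comp_sqrtAbsRes_sq_le hH₀ C hR0 hCR him0 ht0 (by rwa [hre])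
    have b2 := norm_comp_sqrtAbsRes_sq_le hH₀ C hR0 hCR him' ht0 (by rwa [hre'])
    have hJ := norm_nonneg J
    -- The form `k` depends on `z` only through `|Im z|`, so the same bound serves `z` and `z̄`; the
    -- factor `1/2` in the derivative averages the two.
    have c1 : |(⟪g, (res H z - res H₀ z) f⟫_ℂ).re| ≤ ‖J‖ * (k t g + k t f) :=
      h1.trans (mul_le_mul_of_nonneg_left (add_le_add (b2 g) (b1 f)) hJ)
    have c2 : |(⟪g, (res H (conj z) - res H₀ (conj z)) f⟫_ℂ).re| ≤ ‖J‖ * (k t g + k t f) :=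
      h2.trans (mul_le_mul_of_nonneg_left (add_le_add (b1 g) (b2 f)) hJ)
    have e : ((-(1 / 2 : ℂ)) : ℂ) = ((-(1 / 2) : ℝ) : ℂ) := by push_cast; ring
    rw [smul_apply, add_apply, inner_smul_right, inner_add_right, e, Complex.re_ofReal_mul,
      Complex.add_re]
    have d1 := (abs_le.mp c1).2
    have d2 := (abs_le.mp c2).2
    linarith
  · have h := (tendsto_arctanDiff hH₀ hH.selfAdjoint l f)
    have h' : Continuous fun w : E ↦ (⟪g, w⟫_ℂ).re := by fun_prop
    have h'' := (h'.tendsto 0).comp h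
    rwa [inner_zero_right, Complex.zero_re] at h''

theorem tendsto_norm_arctanDiff (hH₀ : IsSelfAdjoint H₀) (hH : IsPerturbation H₀ G J H)
    (hC : IsProduct G (invSqrtAbsAddOne H₀) C) (hCc : IsCompactOperator C) (l : ℝ) :
    Tendsto (fun y ↦ ‖arctanDiff H₀ H l y‖) atTop (𝓝 0) := by
  rw [Metric.tendsto_nhds]
  intro η hη
  have hJ := norm_nonneg J
  -- `20` is the `10` of the majorant times the `2` of `norm_le_of_re_inner_le`. First `ε` is fixed,
  -- then the cut-off `R`, and only then is `y` taken large.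
  obtain ⟨ε, hε, hεη⟩ : ∃ ε : ℝ, 0 < ε ∧ 20 * ‖J‖ * ε ^ 2 < η / 2 := by
    have h : Tendsto (fun ε : ℝ ↦ 20 * ‖J‖ * ε ^ 2) (𝓝[>] 0) (𝓝 0) := by
      have : Continuous fun ε : ℝ ↦ 20 * ‖J‖ * ε ^ 2 := by fun_prop
      have h := this.tendsto 0
      norm_num at h
      exact h.mono_left nhdsWithin_le_nhds
    obtain ⟨ε, h1, h2⟩ :=
      ((h.eventually_lt_const (half_pos hη)).and self_mem_nhdsWithin).exists
    exact ⟨ε, h2, h1⟩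
  obtain ⟨R, hR, hCR⟩ := exists_cutoff hH₀ hCc hε
  obtain ⟨Y, hY, hT⟩ := exists_norm_sandwich_le hH₀ hCc
    (show 0 < 1 / (2 * (‖J‖ + 1)) by positivity)
  have hT' : ∀ z : ℂ, Y ≤ |z.im| → 2 * |z.re| ≤ |z.im| →
      ‖J * C.comp ((absAddOneDivSub H₀ z).comp (ContinuousLinearMap.adjoint C))‖ ≤ 1 / 2 := by
    intro z h1 h2
    refine (norm_mul_le _ _).trans ?_
    calc ‖J‖ * ‖C.comp ((absAddOneDivSub H₀ z).comp (ContinuousLinearMap.adjoint C))‖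
        ≤ (‖J‖ + 1) * (1 / (2 * (‖J‖ + 1))) := by
          gcongr
          · linarith
          · exact hT z h1 h2
      _ = 1 / 2 := by field_simp
  have hlim : Tendsto (fun y : ℝ ↦ 20 * ‖J‖ * ‖C‖ ^ 2 * R / y) atTop (𝓝 0) :=
    tendsto_const_nhds.div_atTop tendsto_id
  filter_upwards [eventually_ge_atTop Y, eventually_ge_atTop (2 * |l|),
    hlim.eventually_lt_const (half_pos hη)] with y h1 h2 h3
  rw [Real.dist_0_eq_abs, abs_norm]
  have hy0 : 0 < y := by linarith
  have h4 := norm_le_of_re_inner_le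
    (b := ‖J‖ * (10 * (‖C‖ ^ 2 * (R / y) + ε ^ 2))) (by positivity)
    (re_inner_arctanDiff_le hH₀ hH hC (l := l) (Y := max Y (2 * |l|)) hR hCR
      (hY.trans (le_max_left _ _)) (le_max_right _ _)
      (fun z h ↦ hT' z ((le_max_left _ _).trans h)) (max_le h1 h2))
  calc ‖arctanDiff H₀ H l y‖ ≤ _ := h4
    _ = 20 * ‖J‖ * ‖C‖ ^ 2 * R / y + 20 * ‖J‖ * ε ^ 2 := by ring
    _ < η := by linarith

/-- A differentiable family on `(0, ∞)` with derivatives in a closed subspace, which tends to zero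
at infinity, takes its values in that subspace. -/
theorem mem_of_hasDerivAt_mem {V : Type*} [NormedAddCommGroup V] [NormedSpace ℝ V]
    {S : Submodule ℝ V} (hS : IsClosed (S : Set V)) {Φ Φ' : ℝ → V}
    (hd : ∀ y, 0 < y → HasDerivAt Φ (Φ' y) y) (hm : ∀ y, 0 < y → Φ' y ∈ S)
    (hlim : Tendsto (fun y ↦ ‖Φ y‖) atTop (𝓝 0)) {y : ℝ} (hy : 0 < y) : Φ y ∈ S := by
  -- Closedness of `S`, as an instance, makes the quotient seminorm a norm.
  have := hS
  let q : V →L[ℝ] V ⧸ S := S.mkQL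
  have hq : ∀ t, 0 < t → HasDerivAt (fun t ↦ q (Φ t)) 0 t := fun t ht ↦ by
    have h := q.hasFDerivAt.comp_hasDerivAt t (hd t ht)
    rwa [show q (Φ' t) = 0 from (Submodule.Quotient.mk_eq_zero S).mpr (hm t ht)] at h
  have hconst : ∀ t, 0 < t → q (Φ t) = q (Φ y) := fun t ht ↦
    isOpen_Ioi.is_const_of_deriv_eq_zero isPreconnected_Ioi
      (fun s hs ↦ (hq s hs).differentiableAt.differentiableWithinAt)
      (fun s hs ↦ (hq s hs).deriv) (mem_Ioi.mpr ht) (mem_Ioi.mpr hy)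
  have h0 : ‖q (Φ y)‖ ≤ 0 := by
    refine ge_of_tendsto hlim ?_
    filter_upwards [eventually_gt_atTop 0] with t ht
    rw [← hconst t ht]
    exact Submodule.Quotient.norm_mk_le S (Φ t)
  exact (Submodule.Quotient.mk_eq_zero S).mp (norm_le_zero_iff.mp h0)

theorem isCompactOperator_arctanDiff (hH₀ : IsSelfAdjoint H₀) (hH : IsPerturbation H₀ G J H)
    (hC : IsProduct G (invSqrtAbsAddOne H₀) C) (hCc : IsCompactOperator C) (l : ℝ) {y : ℝ}
    (hy : 0 < y) : IsCompactOperator (arctanDiff H₀ H l y) := by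
  refine mem_of_hasDerivAt_mem
    (S := (compactOperator (RingHom.id ℂ) E E).restrictScalars ℝ)
    isClosed_setOfPred_isCompactOperator
    (fun y hy ↦ hasDerivAt_arctanDiff hH₀ hH.selfAdjoint l hy) (fun t ht ↦ ?_)
    (tendsto_norm_arctanDiff hH₀ hH hC hCc l) hy
  have hz : (l + t * Complex.I : ℂ).im ≠ 0 := by simpa using ht.ne'
  have hz' : (conj (l + t * Complex.I : ℂ)).im ≠ 0 := by simpa using ht.ne'
  exact (compactOperator (RingHom.id ℂ) E E).smul_mem _
    (add_mem (isCompactOperator_res_sub_res hH₀ hH hC hCc hz)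
      (isCompactOperator_res_sub_res hH₀ hH hC hCc hz'))

end Difference

end SelfAdjointPair

end

theorem theoremf {E F : Type*}
    [NormedAddCommGroup E] [InnerProductSpace ℂ E] [CompleteSpace E]
    [NormedAddCommGroup F] [InnerProductSpace ℂ F] [CompleteSpace F]
    (H₀ : E →ₗ.[ℂ] E) (hH₀ : IsSelfAdjoint H₀)
    (G : E →ₗ.[ℂ] F) (J : F →L[ℂ] F)
    (hGJ : SelfAdjointPair.Admissible H₀ G J)
    (H : E →ₗ.[ℂ] E) (hH : SelfAdjointPair.IsPerturbation H₀ G J H) :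
    SelfAdjointPair.ArgCondition H₀ H := by
  obtain ⟨C, hC, hCc⟩ := hGJ.compact
  refine ⟨fun z hz ↦ ?_, fun l ↦ ?_⟩
  · rw [SelfAdjointPair.argSub_sub_argSub hH₀ hH.selfAdjoint hz]
    exact SelfAdjointPair.isCompactOperator_arctanDiff hH₀ hH hC hCc z.re hz
  · refine (SelfAdjointPair.tendsto_norm_arctanDiff hH₀ hH hC hCc l).congr' ?_
    filter_upwards [eventually_gt_atTop 0] with y hy
    have him : (l + y * Complex.I : ℂ).im = y := by simp
    have hre : (l + y * Complex.I : ℂ).re = l := by simp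
    rw [SelfAdjointPair.argSub_sub_argSub hH₀ hH.selfAdjoint (by rwa [him]), hre, him]
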